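/- **Setting.** Let $\mathbf k$ be a field of characteristic $0$, $P$ a $\mathbf k[\partial]$-module, $\otimes=\otimes_{\mathbf k}$, $I$ the identity, $\tau(u\otimes v)=v\otimes u$, $\partial^{\otimes^2}=\partial\otimes I+I\otimes\partial$ and $\partial^{\otimes^3}=\partial\otimes I\otimes I+I\otimes\partial\otimes I+I\otimes I\otimes\partial$. A $\lambda$-product is a $\mathbf k$-bilinear map $P\times P\to P[\lambda]$. When the formal variable of an expression $\sum_n\lambda^n p_n$ with $p_n\in P^{\otimes s}$ is replaced by a polynomial $T$ in $\lambda$ and the operators $\partial$ in the tensor slots, the result is $\sum_n T^n p_n$. **Poisson conformal algebras.** $(P,[\cdot_\lambda\cdot],\cdot_\lambda\cdot)$ is a Poisson conformal algebra if for all $a,b,c\in P$: $[(\partial a)_\lambda b]=-\lambda[a_\lambda b]$, $[a_\lambda(\partial b)]=(\partial+\lambda)[a_\lambda b]$, $[a_\lambda b]=-[b_{-\lambda-\partial}a]$, $[a_\lambda[b_\mu c]]=[[a_\lambda b]_{\lambda+\mu}c]+[b_\mu[a_\lambda c]]$ (Lie conformal algebra); $(\partial a)_\lambda b=-\lambda\,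 a_\lambda b$, $a_\lambda(\partial b)=(\partial+\lambda)a_\lambda b$, $(a_\lambda b)_{\lambda+\mu}c=a_\lambda(b_\mu c)$, $a_\lambda b=b_{-\lambda-\partial}a$ (commutative associative conformal algebra); and $[a_\lambda(b_\mu c)]=[a_\lambda b]_{\lambda+\mu}c+b_\mu[a_\lambda c]$. Write $\mathfrak{ad}(a)_\lambda b=[a_\lambda b]$, $\mathfrak L(a)_\lambda b=a_\lambda b$, $\mathfrak R(a)_\lambda b=b_{-\lambda-\partial}a$. **Poisson conformal bialgebras.** Let $\delta,\Delta:P\to P\otimes P$ be $\mathbf k$-linear. $(P,[\cdot_\lambda\cdot],\cdot_\lambda\cdot,\delta,\Delta)$ is a Poisson conformal bialgebra if $(P,[\cdot_\lambda\cdot],\cdot_\lambda\cdot)$ is a Poisson conformal algebra, $\delta\partial=\partial^{\otimes^2}\delta$, $\Delta\partial=\partial^{\otimes^2}\Delta$, and for all $a,b\in P$: 1. $\delta(a)=-\tau\delta(a)$ and $(I\otimes\delta)\delta(a)-(\tau\otimes I)(I\otimes\delta)\delta(a)=(\delta\otimes I)\delta(a)$; 2. $\Delta(a)=\tau\Delta(a)$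 and $(I\otimes\Delta)\Delta(a)=(\Delta\otimes I)\Delta(a)$; 3. $(I\otimes\Delta)\delta(a)=(\delta\otimes I)\Delta(a)+(\tau\otimes I)(I\otimes\delta)\Delta(a)$; 4. $\delta([a_\lambda b])=(\mathfrak{ad}(a)_\lambda\otimes I+I\otimes\mathfrak{ad}(a)_\lambda)\delta(b)-(\mathfrak{ad}(b)_{-\lambda-\partial^{\otimes^2}}\otimes I+I\otimes\mathfrak{ad}(b)_{-\lambda-\partial^{\otimes^2}})\delta(a)$; 5. $\Delta(a_\lambda b)=(I\otimes\mathfrak L(a)_\lambda)\Delta(b)+(\mathfrak R(b)_{-\lambda-\partial^{\otimes^2}}\otimes I)\Delta(a)$; 6. $(\mathfrak L(b)_{-\lambda-\partial^{\otimes^2}}\otimes I-I\otimes\mathfrak R(b)_{-\lambda-\partial^{\otimes^2}})\Delta(a)+\tau(\mathfrak L(a)_\lambda\otimes I-I\otimes\mathfrak R(a)_\lambda)\Delta(b)=0$; 7. $\delta(a_\lambda b)=(\mathfrak L(a)_\lambda\otimes I)\delta(b)+(\mathfrak L(b)_{-\lambda-\partial^{\otimes^2}}\otimes I)\delta(a)+(I\otimes\mathfrak{ad}(a)_\lambda)\Delta(b)+(I\otimes\mathfrak{ad}(b)_{-\lambda-\partial^{\otimes^2}})\Delta(a)$;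 8. $\Delta([a_\lambda b])=(\mathfrak{ad}(a)_\lambda\otimes I+I\otimes\mathfrak{ad}(a)_\lambda)\Delta(b)-(I\otimes\mathfrak L(b)_{-\lambda-\partial^{\otimes^2}})\delta(a)+(\mathfrak L(b)_{-\lambda-\partial^{\otimes^2}}\otimes I)\delta(a)$. **Theorem.** Let $(P,[\cdot_\lambda\cdot],\cdot_\lambda\cdot)$ be a Poisson conformal algebra and $r=\sum_i r_i\otimes l_i\in P\otimes P$. Define $$\delta(a)=(\mathfrak{ad}(a)_\lambda\otimes I+I\otimes\mathfrak{ad}(a)_\lambda)r|_{\lambda=-\partial^{\otimes^2}},\qquad \Delta(a)=(I\otimes\mathfrak L(a)_\lambda-\mathfrak L(a)_\lambda\otimes I)r|_{\lambda=-\partial^{\otimes^2}},$$ $$[[r,r]]=\sum_{i,j}\big([{r_i}_\mu r_j]\otimes l_i\otimes l_j|_{\mu=I\otimes\partial\otimes I}-r_i\otimes[{r_j}_\mu l_i]\otimes l_j|_{\mu=I\otimes I\otimes\partial}-r_i\otimes r_j\otimes[{l_j}_\mu l_i]|_{\mu=I\otimes\partial\otimes I}\big),$$ $$r\bullet r=\sum_{i,j}\big(r_i\otimes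 r_j\otimes {l_i}_\mu l_j|_{\mu=\partial\otimes I\otimes I}-r_i\otimes {r_j}_\mu l_i\otimes l_j|_{\mu=-\partial^{\otimes^2}\otimes I}+{r_i}_\mu r_j\otimes l_i\otimes l_j|_{\mu=I\otimes\partial\otimes I}\big).$$ Then $(P,[\cdot_\lambda\cdot],\cdot_\lambda\cdot,\delta,\Delta)$ is a Poisson conformal bialgebra if and only if for all $a\in P$: (a) $(\mathfrak{ad}(a)_\lambda\otimes I+I\otimes\mathfrak{ad}(a)_\lambda)(r+\tau r)|_{\lambda=-\partial^{\otimes^2}}=0$; (b) $(I\otimes\mathfrak L(a)_\lambda-\mathfrak L(a)_\lambda\otimes I)(r+\tau r)|_{\lambda=-\partial^{\otimes^2}}=0$; (c) $(\mathfrak{ad}(a)_\lambda\otimes I\otimes I+I\otimes\mathfrak{ad}(a)_\lambda\otimes I+I\otimes I\otimes\mathfrak{ad}(a)_\lambda)[[r,r]]|_{\lambda=-\partial^{\otimes^3}}=0$; (d) $(I\otimes I\otimes\mathfrak L(a)_\lambda-\mathfrak L(a)_\lambda\otimes I\otimes I)(r\bullet r)|_{\lambda=-\partial^{\otimes^3}}=0$;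 (e) $(\mathfrak{ad}(a)_\lambda\otimes I\otimes I)(r\bullet r)|_{\lambda=-\partial^{\otimes^3}}-(I\otimes\mathfrak L(a)_\lambda\otimes I-I\otimes I\otimes\mathfrak L(a)_\lambda)[[r,r]]|_{\lambda=-\partial^{\otimes^3}}+\sum_i(\mathfrak{ad}(r_i)_\mu\otimes I\otimes I)\,w_i|_{\mu=I\otimes I\otimes\partial}=0$, where $w_i=(\mathfrak L(a)_\lambda\otimes I\otimes I-I\otimes\mathfrak L(a)_\lambda\otimes I)\big((r+\tau r)\otimes l_i\big)|_{\lambda=-\partial^{\otimes^2}\otimes I}$. -/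

import Mathlib

open scoped TensorProduct

noncomputable section

namespace PoissonConformal

/-! ### Polynomials with coefficients in a vector space

`Pol V` is the space `V[λ]`; a finitely supported `p : ℕ →₀ V` stands for `∑ₙ λⁿ pₙ`. -/

/-- `V[λ]`, the polynomials in one formal variable with coefficients in `V`. -/
abbrev Pol (V : Type*) [AddCommGroup V] : Type _ := ℕ →₀ V

section Pol

variable {k : Type*} [Field k]
variable {V : Type*} [AddCommGroup V] [Module k V]
variable {W : Type*} [AddCommGroup W] [Module k W]

/-- Constant polynomials, `V → V[λ]`. -/
def const (k : Type*) [Field k] (V : Type*) [AddCommGroup V] [Module k V] : V →ₗ[k] Pol V :=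
  Finsupp.lsingle 0

/-- Multiplication by `λ` on `V[λ]`. -/
def lam (k : Type*) [Field k] (V : Type*) [AddCommGroup V] [Module k V] : Module.End k (Pol V) :=
  Finsupp.lmapDomain V k Nat.succ

/-- A linear map applied to the coefficients of a polynomial, `V[λ] → W[λ]`. -/
def coeffwise (f : V →ₗ[k] W) : Pol V →ₗ[k] Pol W :=
  Finsupp.mapRange.linearMap f

/-- Substitution: `∑ₙ λⁿ pₙ ↦ ∑ₙ Tⁿ (f pₙ)`, i.e. the coefficients are sent to `W` by `f` and the
formal variable is replaced by the operator `T` on `W`. -/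
def subst (T : Module.End k W) (f : V →ₗ[k] W) : Pol V →ₗ[k] W :=
  Finsupp.lsum k fun n => (T ^ n) ∘ₗ f

/-- `p(λ) ↦ p(λ)|_{λ = T}` for an operator `T` on `V`. -/
def evalAt (T : Module.End k V) : Pol V →ₗ[k] V :=
  subst T LinearMap.id

/-- `p(λ) ↦ p(-λ-D)` on `V[λ]`, for an operator `D` on `V`. -/
def negSubst (D : Module.End k V) : Pol V →ₗ[k] Pol V :=
  subst (-lam k V - coeffwise D) (const k V)

end Pol

section Tensor

variable {k : Type*} [Field k]
variable {V : Type*} [AddCommGroup V] [Module k V]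
variable {W : Type*} [AddCommGroup W] [Module k W]

/-- `g_λ ⊗ I : V ⊗ W → (V ⊗ W)[λ]` for `g_λ : V → V[λ]`. -/
def onLeft (W : Type*) [AddCommGroup W] [Module k W] (g : V →ₗ[k] Pol V) :
    V ⊗[k] W →ₗ[k] Pol (V ⊗[k] W) :=
  (TensorProduct.finsuppLeft k k V W ℕ).toLinearMap ∘ₗ g.rTensor W

/-- `I ⊗ g_λ : V ⊗ W → (V ⊗ W)[λ]` for `g_λ : W → W[λ]`. -/
def onRight (V : Type*) [AddCommGroup V] [Module k V] (g : W →ₗ[k] Pol W) :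
    V ⊗[k] W →ₗ[k] Pol (V ⊗[k] W) :=
  (TensorProduct.finsuppRight k k V W ℕ).toLinearMap ∘ₗ g.lTensor V

variable {P : Type*} [AddCommGroup P] [Module k P]

/-- The flip `τ : P ⊗ P → P ⊗ P`. -/
def tau (k : Type*) [Field k] (P : Type*) [AddCommGroup P] [Module k P] :
    P ⊗[k] P →ₗ[k] P ⊗[k] P :=
  (TensorProduct.comm k P P).toLinearMap

/-- `τ ⊗ I : P ⊗ P ⊗ P → P ⊗ P ⊗ P`. -/
def tau12 (k : Type*) [Field k] (P : Type*) [AddCommGroup P] [Module k P] :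
    P ⊗[k] (P ⊗[k] P) →ₗ[k] P ⊗[k] (P ⊗[k] P) :=
  (TensorProduct.leftComm k P P P).toLinearMap

/-- `f ⊗ I : P ⊗ P → P ⊗ P ⊗ P` for `f : P → P ⊗ P`. -/
def coLeft (f : P →ₗ[k] P ⊗[k] P) : P ⊗[k] P →ₗ[k] P ⊗[k] (P ⊗[k] P) :=
  (TensorProduct.assoc k P P P).toLinearMap ∘ₗ f.rTensor P

/-- `I ⊗ f : P ⊗ P → P ⊗ P ⊗ P` for `f : P → P ⊗ P`. -/
def coRight (f : P →ₗ[k] P ⊗[k] P) : P ⊗[k] P →ₗ[k] P ⊗[k] (P ⊗[k] P) :=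
  f.lTensor P

/-- `∂^{⊗2} = ∂ ⊗ I + I ⊗ ∂`. -/
def del2 (D : Module.End k P) : Module.End k (P ⊗[k] P) :=
  D.rTensor P + D.lTensor P

/-- `∂ ⊗ I ⊗ I`. -/
def delA (D : Module.End k P) : Module.End k (P ⊗[k] (P ⊗[k] P)) :=
  D.rTensor (P ⊗[k] P)

/-- `I ⊗ ∂ ⊗ I`. -/
def delB (D : Module.End k P) : Module.End k (P ⊗[k] (P ⊗[k] P)) :=
  (D.rTensor P).lTensor P

/-- `I ⊗ I ⊗ ∂`. -/
def delC (D : Module.End k P) : Module.End k (P ⊗[k] (P ⊗[k] P)) :=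
  (D.lTensor P).lTensor P

/-- `∂^{⊗3} = ∂ ⊗ I ⊗ I + I ⊗ ∂ ⊗ I + I ⊗ I ⊗ ∂`. -/
def del3 (D : Module.End k P) : Module.End k (P ⊗[k] (P ⊗[k] P)) :=
  delA D + delB D + delC D

/-- `g_λ ⊗ I ⊗ I`. -/
def onA (g : P →ₗ[k] Pol P) : P ⊗[k] (P ⊗[k] P) →ₗ[k] Pol (P ⊗[k] (P ⊗[k] P)) :=
  onLeft (P ⊗[k] P) g

/-- `I ⊗ g_λ ⊗ I`. -/
def onB (g : P →ₗ[k] Pol P) : P ⊗[k] (P ⊗[k] P) →ₗ[k] Pol (P ⊗[k] (P ⊗[k] P)) :=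
  onRight P (onLeft P g)

/-- `I ⊗ I ⊗ g_λ`. -/
def onC (g : P →ₗ[k] Pol P) : P ⊗[k] (P ⊗[k] P) →ₗ[k] Pol (P ⊗[k] (P ⊗[k] P)) :=
  onRight P (onRight P g)

/-- `z ↦ z ⊗ u ⊗ v`. -/
def insA (u v : P) : P →ₗ[k] P ⊗[k] (P ⊗[k] P) :=
  (TensorProduct.mk k P (P ⊗[k] P)).flip (u ⊗ₜ[k] v)

/-- `z ↦ u ⊗ z ⊗ v`. -/
def insB (u v : P) : P →ₗ[k] P ⊗[k] (P ⊗[k] P) :=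
  TensorProduct.mk k P (P ⊗[k] P) u ∘ₗ (TensorProduct.mk k P P).flip v

/-- `z ↦ u ⊗ v ⊗ z`. -/
def insC (u v : P) : P →ₗ[k] P ⊗[k] (P ⊗[k] P) :=
  TensorProduct.mk k P (P ⊗[k] P) u ∘ₗ TensorProduct.mk k P P v

/-- `t ⊗ z` in `P ⊗ P ⊗ P` for `t` in `P ⊗ P` and `z` in `P`. -/
def tensorRight (t : P ⊗[k] P) (z : P) : P ⊗[k] (P ⊗[k] P) :=
  TensorProduct.assoc k P P P (t ⊗ₜ[k] z)

end Tensor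

/-! ### Conformal algebras

A `k[∂]`-module is a `k`-vector space `P` with a linear operator `D`, the action of `∂`.
A `λ`-product `a_λ b` is a `k`-bilinear map `P × P → P[λ]`. -/

section Algebra

variable {k : Type*} [Field k] {P : Type*} [AddCommGroup P] [Module k P]

/-- The embedding `P → P[λ, μ] = (P[λ])[μ]`. -/
def const2 (k : Type*) [Field k] (P : Type*) [AddCommGroup P] [Module k P] :
    P →ₗ[k] Pol (Pol P) :=
  const k (Pol P) ∘ₗ const k P

/-- Multiplication by `λ` on `P[λ, μ] = (P[λ])[μ]`. -/
def lam2 (k : Type*) [Field k] (P : Type*) [AddCommGroup P] [Module k P] :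
    Module.End k (Pol (Pol P)) :=
  coeffwise (lam k P)

/-- Multiplication by `μ` on `P[λ, μ] = (P[λ])[μ]`. -/
def mu2 (k : Type*) [Field k] (P : Type*) [AddCommGroup P] [Module k P] :
    Module.End k (Pol (Pol P)) :=
  lam k (Pol P)

/-- `a _λ (b _μ c)` in `P[λ, μ]`, where `f` is the product with variable `λ`, `g` the one with
variable `μ`. -/
def nestL (f g : P →ₗ[k] P →ₗ[k] Pol P) (a b c : P) : Pol (Pol P) :=
  subst (mu2 k P) (subst (lam2 k P) (const2 k P) ∘ₗ f a) (g b c)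

/-- `b _μ (a _λ c)` in `P[λ, μ]`, where `f` is the product with variable `μ`, `g` the one with
variable `λ`. -/
def nestM (f g : P →ₗ[k] P →ₗ[k] Pol P) (b a c : P) : Pol (Pol P) :=
  subst (lam2 k P) (subst (mu2 k P) (const2 k P) ∘ₗ f b) (g a c)

/-- `(a _λ b) _{λ+μ} c` in `P[λ, μ]`, where `f` is the product with variable `λ`, `g` the one with
variable `λ + μ`. -/
def nestLM (f g : P →ₗ[k] P →ₗ[k] Pol P) (a b c : P) : Pol (Pol P) :=
  subst (lam2 k P) (subst (lam2 k P + mu2 k P) (const2 k P) ∘ₗ g.flip c) (f a b)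

/-- Conformal sesquilinearity: `(∂a)_λ b = -λ a_λ b` and `a_λ (∂b) = (∂ + λ) a_λ b`. -/
structure IsSesquilinear (D : Module.End k P) (m : P →ₗ[k] P →ₗ[k] Pol P) : Prop where
  left : ∀ a b, m (D a) b = -lam k P (m a b)
  right : ∀ a b, m a (D b) = coeffwise D (m a b) + lam k P (m a b)

/-- Associative conformal algebras: `(a_λ b)_{λ+μ} c = a_λ (b_μ c)`. -/
structure IsAssocConformalAlgebra (D : Module.End k P) (m : P →ₗ[k] P →ₗ[k] Pol P) : Prop where
  sesquilinear : IsSesquilinear D m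
  assoc : ∀ a b c, nestLM m m a b c = nestL m m a b c

/-- Commutativity: `a_λ b = b_{-λ-∂} a`. -/
def IsCommutative (D : Module.End k P) (m : P →ₗ[k] P →ₗ[k] Pol P) : Prop :=
  ∀ a b, m a b = negSubst D (m b a)

/-- Lie conformal algebras: `[a_λ b] = -[b_{-λ-∂} a]` and
`[a_λ [b_μ c]] = [[a_λ b]_{λ+μ} c] + [b_μ [a_λ c]]`. -/
structure IsLieConformalAlgebra (D : Module.End k P) (br : P →ₗ[k] P →ₗ[k] Pol P) : Prop where
  sesquilinear : IsSesquilinear D br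
  skew : ∀ a b, br a b = -negSubst D (br b a)
  jacobi : ∀ a b c, nestL br br a b c = nestLM br br a b c + nestM br br b a c

/-- Poisson conformal algebras: a Lie conformal algebra and a commutative associative conformal
algebra with `[a_λ (b_μ c)] = [a_λ b]_{λ+μ} c + b_μ [a_λ c]`. -/
structure IsPoissonConformalAlgebra (D : Module.End k P) (br m : P →ₗ[k] P →ₗ[k] Pol P) :
    Prop where
  lie : IsLieConformalAlgebra D br
  assoc : IsAssocConformalAlgebra D m
  comm : IsCommutative D m
  leibniz : ∀ a b c, nestL br m a b c = nestLM br m a b c + nestM m br b a c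

/-- Right multiplication `R(a)_λ b = b_{-λ-∂} a`. (Left multiplication `L(a)_λ` is `m a`, and
the adjoint action `ad(a)_λ` is `br a`.) -/
def rmul (D : Module.End k P) (m : P →ₗ[k] P →ₗ[k] Pol P) (a : P) : P →ₗ[k] Pol P :=
  negSubst D ∘ₗ m.flip a

end Algebra

/-! ### Conformal coalgebras and bialgebras -/

section Coalgebra

variable {k : Type*} [Field k] {P : Type*} [AddCommGroup P] [Module k P]

/-- `f : P → P ⊗ P` is a homomorphism of `k[∂]`-modules. -/
def IsEquivariant (D : Module.End k P) (f : P →ₗ[k] P ⊗[k] P) : Prop :=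
  ∀ a, f (D a) = del2 D (f a)

/-- Associative conformal coalgebras. -/
structure IsAssocConformalCoalgebra (D : Module.End k P) (Δ : P →ₗ[k] P ⊗[k] P) : Prop where
  equivariant : IsEquivariant D Δ
  coassoc : ∀ a, coRight Δ (Δ a) = coLeft Δ (Δ a)

/-- Cocommutativity: `Δ = τ Δ`. -/
def IsCocommutative (Δ : P →ₗ[k] P ⊗[k] P) : Prop :=
  ∀ a, Δ a = tau k P (Δ a)

/-- Lie conformal coalgebras. -/
structure IsLieConformalCoalgebra (D : Module.End k P) (δ : P →ₗ[k] P ⊗[k] P) : Prop where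
  equivariant : IsEquivariant D δ
  coskew : ∀ a, δ a = -tau k P (δ a)
  cojacobi : ∀ a, coRight δ (δ a) - tau12 k P (coRight δ (δ a)) = coLeft δ (δ a)

/-- Poisson conformal coalgebras. -/
structure IsPoissonConformalCoalgebra (D : Module.End k P) (δ Δ : P →ₗ[k] P ⊗[k] P) : Prop where
  lie : IsLieConformalCoalgebra D δ
  coassoc : IsAssocConformalCoalgebra D Δ
  cocomm : IsCocommutative Δ
  compat : ∀ a, coRight Δ (δ a) = coLeft δ (Δ a) + tau12 k P (coRight δ (Δ a))

/-- `(g_λ ⊗ I) t |_{λ ↦ -λ-∂^{⊗2}}` in `(P ⊗ P)[λ]`. -/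
def negLeft (D : Module.End k P) (g : P →ₗ[k] Pol P) (t : P ⊗[k] P) : Pol (P ⊗[k] P) :=
  negSubst (del2 D) (onLeft P g t)

/-- `(I ⊗ g_λ) t |_{λ ↦ -λ-∂^{⊗2}}` in `(P ⊗ P)[λ]`. -/
def negRight (D : Module.End k P) (g : P →ₗ[k] Pol P) (t : P ⊗[k] P) : Pol (P ⊗[k] P) :=
  negSubst (del2 D) (onRight P g t)

/-- Antisymmetric infinitesimal conformal bialgebras. -/
structure IsASIConformalBialgebra (D : Module.End k P) (m : P →ₗ[k] P →ₗ[k] Pol P)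
    (Δ : P →ₗ[k] P ⊗[k] P) : Prop where
  alg : IsAssocConformalAlgebra D m
  coalg : IsAssocConformalCoalgebra D Δ
  compat₁ : ∀ a b, coeffwise Δ (m a b) = onRight P (m a) (Δ b) + negLeft D (rmul D m b) (Δ a)
  compat₂ : ∀ a b, negLeft D (m b) (Δ a) - negRight D (rmul D m b) (Δ a)
    + coeffwise (tau k P) (onLeft P (m a) (Δ b) - onRight P (rmul D m a) (Δ b)) = 0

/-- Lie conformal bialgebras. -/
structure IsLieConformalBialgebra (D : Module.End k P) (br : P →ₗ[k] P →ₗ[k] Pol P)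
    (δ : P →ₗ[k] P ⊗[k] P) : Prop where
  alg : IsLieConformalAlgebra D br
  coalg : IsLieConformalCoalgebra D δ
  cocycle : ∀ a b, coeffwise δ (br a b)
    = (onLeft P (br a) (δ b) + onRight P (br a) (δ b))
      - (negLeft D (br b) (δ a) + negRight D (br b) (δ a))

/-- Poisson conformal bialgebras. -/
structure IsPoissonConformalBialgebra (D : Module.End k P) (br m : P →ₗ[k] P →ₗ[k] Pol P)
    (δ Δ : P →ₗ[k] P ⊗[k] P) : Prop where
  alg : IsPoissonConformalAlgebra D br m
  coalg : IsPoissonConformalCoalgebra D δ Δ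
  lieBialg : IsLieConformalBialgebra D br δ
  asiBialg : IsASIConformalBialgebra D m Δ
  comm : IsCommutative D m
  cocomm : IsCocommutative Δ
  compat₁ : ∀ a b, coeffwise δ (m a b)
    = onLeft P (m a) (δ b) + negLeft D (m b) (δ a)
      + onRight P (br a) (Δ b) + negRight D (br b) (Δ a)
  compat₂ : ∀ a b, coeffwise Δ (br a b)
    = (onLeft P (br a) (Δ b) + onRight P (br a) (Δ b))
      - negRight D (m b) (δ a) + negLeft D (m b) (δ a)

end Coalgebra

/-! ### The coboundary maps and the Yang–Baxter expressions -/

section Coboundary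

variable {k : Type*} [Field k] {P : Type*} [AddCommGroup P] [Module k P]

theorem onLeft_add (g h : P →ₗ[k] Pol P) : onLeft P (g + h) = onLeft P g + onLeft P h := by
  simp only [onLeft, LinearMap.rTensor_add, LinearMap.comp_add]

theorem onLeft_smul (c : k) (g : P →ₗ[k] Pol P) : onLeft P (c • g) = c • onLeft P g := by
  simp only [onLeft, LinearMap.rTensor_smul, LinearMap.comp_smul]

theorem onRight_add (g h : P →ₗ[k] Pol P) : onRight P (g + h) = onRight P g + onRight P h := by
  simp only [onRight, LinearMap.lTensor_add, LinearMap.comp_add]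

theorem onRight_smul (c : k) (g : P →ₗ[k] Pol P) : onRight P (c • g) = c • onRight P g := by
  simp only [onRight, LinearMap.lTensor_smul, LinearMap.comp_smul]

/-- `δ(a) = (ad(a)_λ ⊗ I + I ⊗ ad(a)_λ) r |_{λ = -∂^{⊗2}}`. -/
def coboundaryLie (D : Module.End k P) (br : P →ₗ[k] P →ₗ[k] Pol P) (r : P ⊗[k] P) :
    P →ₗ[k] P ⊗[k] P where
  toFun a := evalAt (-del2 D) ((onLeft P (br a) + onRight P (br a)) r)
  map_add' a b := by
    rw [← map_add, ← LinearMap.add_apply, map_add, onLeft_add, onRight_add, add_add_add_comm]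
  map_smul' c a := by
    rw [RingHom.id_apply, ← map_smul, ← LinearMap.smul_apply, map_smul, onLeft_smul, onRight_smul,
      smul_add]

/-- `Δ(a) = (I ⊗ L(a)_λ - L(a)_λ ⊗ I) r |_{λ = -∂^{⊗2}}`. -/
def coboundaryAssoc (D : Module.End k P) (m : P →ₗ[k] P →ₗ[k] Pol P) (r : P ⊗[k] P) :
    P →ₗ[k] P ⊗[k] P where
  toFun a := evalAt (-del2 D) ((onRight P (m a) - onLeft P (m a)) r)
  map_add' a b := by
    rw [← map_add, ← LinearMap.add_apply, map_add, onLeft_add, onRight_add, add_sub_add_comm]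
  map_smul' c a := by
    rw [RingHom.id_apply, ← map_smul, ← LinearMap.smul_apply, map_smul, onLeft_smul, onRight_smul,
      smul_sub]

variable {ι : Type*} [Fintype ι]

/-- `[[r, r]]` for `r = ∑ᵢ xᵢ ⊗ yᵢ`, that is
`∑ᵢⱼ ([xᵢ_μ xⱼ] ⊗ yᵢ ⊗ yⱼ |_{μ = I⊗∂⊗I} - xᵢ ⊗ [xⱼ_μ yᵢ] ⊗ yⱼ |_{μ = I⊗I⊗∂}
  - xᵢ ⊗ xⱼ ⊗ [yⱼ_μ yᵢ] |_{μ = I⊗∂⊗I})`. -/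
def cybe (D : Module.End k P) (br : P →ₗ[k] P →ₗ[k] Pol P) (x y : ι → P) :
    P ⊗[k] (P ⊗[k] P) :=
  ∑ i, ∑ j,
    (subst (delB D) (insA (y i) (y j)) (br (x i) (x j))
      - subst (delC D) (insB (x i) (y j)) (br (x j) (y i))
      - subst (delB D) (insC (x i) (x j)) (br (y j) (y i)))

/-- `r • r` for `r = ∑ᵢ xᵢ ⊗ yᵢ`, that is
`∑ᵢⱼ (xᵢ ⊗ xⱼ ⊗ yᵢ_μ yⱼ |_{μ = ∂⊗I⊗I} - xᵢ ⊗ xⱼ_μ yᵢ ⊗ yⱼ |_{μ = -∂^{⊗2}⊗I}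
  + xᵢ_μ xⱼ ⊗ yᵢ ⊗ yⱼ |_{μ = I⊗∂⊗I})`. -/
def aybe (D : Module.End k P) (m : P →ₗ[k] P →ₗ[k] Pol P) (x y : ι → P) :
    P ⊗[k] (P ⊗[k] P) :=
  ∑ i, ∑ j,
    (subst (delA D) (insC (x i) (x j)) (m (y i) (y j))
      - subst (-(delA D + delB D)) (insB (x i) (y j)) (m (x j) (y i))
      + subst (delB D) (insA (y i) (y j)) (m (x i) (x j)))

end Coboundary

end PoissonConformal

end

open scoped TensorProduct

noncomputable section

namespace PoissonConformal

/-! ### Substitution of operators for the formal variable -/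

section Calculus

variable {k : Type*} [Field k]
variable {V : Type*} [AddCommGroup V] [Module k V]
variable {W : Type*} [AddCommGroup W] [Module k W]
variable {W' : Type*} [AddCommGroup W'] [Module k W']
variable {U : Type*} [AddCommGroup U] [Module k U]

/-! Write r = ∑ xᵢ ⊗ yᵢ. The proof rests on giving every argument of a λ-product its own variable,
an operator on the target space, subject to one conservation law: the variables of all arguments and
the operator by which ∂ acts on the value of the product add up to zero. With this convention the
substitutions λ ↦ -λ-∂ and λ+μ disappear, and the axioms read like those of an ordinary Poisson
algebra: `nest_swap`, `nest_jacobi`, `nest_leibniz`, `nest_assoc`. Every expression in the theorem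
expands into two shapes only: a double product in one tensor slot (`nest`) and two products in two
different slots (`pair`). For the triple tensors, the normal form gives `a` the variable -∂^{⊗3} and
gives a leg of a copy of r the derivation in the slot of its other leg.

The compatibility conditions 4, 5, 7 and 8 hold for the coboundary maps of any r, because δ and Δ
are built from the actions of the algebra; condition 6 follows as soon as Δ is cocommutative. Hence
the bialgebra property reduces to the coalgebra axioms (`isPoissonConformalBialgebra_of_coalgebra`).

Conditions (a) and (b) are skew-symmetry of δ and cocommutativity of Δ, since the operator defining
δ commutes with τ and the one defining Δ anticommutes with it (`evalAt_add_tau`, `evalAt_sub_tau`).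
The remaining three axioms are handled by computing their defects for arbitrary r: the defect of
coassociativity is the left side of (d) (`coassoc_defect`), that of the co-Leibniz rule is the left
side of (e) (`coleibniz_defect`), and that of co-Jacobi is the left side of (c) plus a correction
which (a) annihilates (`cojacobi_defect`). In each computation the summands for the copies i and j
of r agree up to a term antisymmetric in i and j, which the double sum kills. -/

theorem subst_single (T : Module.End k W) (φ : V →ₗ[k] W) (n : ℕ) (v : V) :
    subst T φ (Finsupp.single n v) = (T ^ n) (φ v) := by
  simp [subst]

theorem subst_const (T : Module.End k W) (φ : V →ₗ[k] W) (v : V) :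
    subst T φ (const k V v) = φ v := by
  simp [const, subst_single]

theorem subst_comp_const (T : Module.End k W) (φ : V →ₗ[k] W) :
    subst T φ ∘ₗ const k V = φ :=
  LinearMap.ext (subst_const T φ)

theorem subst_comp_lam (T : Module.End k W) (φ : V →ₗ[k] W) :
    subst T φ ∘ₗ lam k V = T ∘ₗ subst T φ := by
  refine Finsupp.lhom_ext fun n v => ?_
  simp [lam, subst_single, pow_succ']

theorem subst_lam (T : Module.End k W) (φ : V →ₗ[k] W) (p : Pol V) :
    subst T φ (lam k V p) = T (subst T φ p) :=
  LinearMap.congr_fun (subst_comp_lam T φ) p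

theorem coeffwise_single (h : V →ₗ[k] W) (n : ℕ) (v : V) :
    coeffwise h (Finsupp.single n v) = Finsupp.single n (h v) := by
  simp [coeffwise]

theorem subst_coeffwise (T : Module.End k W) (φ : U →ₗ[k] W) (h : V →ₗ[k] U) (p : Pol V) :
    subst T φ (coeffwise h p) = subst T (φ ∘ₗ h) p := by
  have : subst T φ ∘ₗ coeffwise h = subst T (φ ∘ₗ h) := by
    refine Finsupp.lhom_ext fun n v => ?_
    simp [coeffwise_single, subst_single]
  exact LinearMap.congr_fun this p

theorem evalAt_coeffwise (T : Module.End k W) (h : V →ₗ[k] W) (p : Pol V) :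
    evalAt T (coeffwise h p) = subst T h p := by
  rw [evalAt, subst_coeffwise, LinearMap.id_comp]

theorem comp_pow_of_intertwines {F : W →ₗ[k] W'} {T : Module.End k W} {T' : Module.End k W'}
    (h : F ∘ₗ T = T' ∘ₗ F) (n : ℕ) (w : W) : F ((T ^ n) w) = (T' ^ n) (F w) := by
  induction n with
  | zero => simp
  | succ n ih =>
    rw [pow_succ', pow_succ', Module.End.mul_apply, Module.End.mul_apply, ← ih]
    exact LinearMap.congr_fun h _

/-- A linear map that intertwines `T` and `T'` carries substitution of `T` to substitution
of `T'`. -/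
theorem map_subst {F : W →ₗ[k] W'} {T : Module.End k W} {T' : Module.End k W'}
    (h : F ∘ₗ T = T' ∘ₗ F) (φ : V →ₗ[k] W) (p : Pol V) :
    F (subst T φ p) = subst T' (F ∘ₗ φ) p := by
  have : F ∘ₗ subst T φ = subst T' (F ∘ₗ φ) := by
    refine Finsupp.lhom_ext fun n v => ?_
    simp [subst_single, comp_pow_of_intertwines h]
  exact LinearMap.congr_fun this p

theorem subst_comp_coeffwise {T E : Module.End k W} {φ : V →ₗ[k] W} {D : Module.End k V}
    (hφ : φ ∘ₗ D = E ∘ₗ φ) (hT : Commute T E) :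
    subst T φ ∘ₗ coeffwise D = E ∘ₗ subst T φ := by
  refine LinearMap.ext fun p => ?_
  rw [LinearMap.comp_apply, LinearMap.comp_apply, subst_coeffwise, hφ,
    map_subst (T := T) (T' := T) hT.symm.eq]

/-- `subst` as a linear function of the coefficient map. -/
def substHom (V : Type*) [AddCommGroup V] [Module k V] (T : Module.End k W) :
    (V →ₗ[k] W) →ₗ[k] Pol V →ₗ[k] W where
  toFun φ := subst T φ
  map_add' φ ψ := by
    refine Finsupp.lhom_ext fun n v => ?_
    simp [subst_single]
  map_smul' c φ := by
    refine Finsupp.lhom_ext fun n v => ?_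
    simp [subst_single]

theorem substHom_apply (T : Module.End k W) (φ : V →ₗ[k] W) (p : Pol V) :
    substHom V T φ p = subst T φ p := rfl

/-- Under `φ` the operator `D` becomes `E`, so -λ-D evaluated at λ = T is -T-E. Commutation of `T`
with `E` allows the coefficients and the variable to be evaluated independently. -/
theorem subst_negSubst {T T' E : Module.End k W} {φ : V →ₗ[k] W} {D : Module.End k V}
    (hφ : φ ∘ₗ D = E ∘ₗ φ) (hT : Commute T E) (h : T + T' + E = 0) (p : Pol V) :
    subst T φ (negSubst D p) = subst T' φ p := by
  have hT' : T' = -T - E := by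
    rw [add_right_comm] at h
    rw [eq_neg_of_add_eq_zero_right h]; abel
  rw [negSubst, map_subst (T' := T'), subst_comp_const]
  rw [hT', LinearMap.comp_sub, LinearMap.comp_neg, subst_comp_lam, subst_comp_coeffwise hφ hT,
    LinearMap.sub_comp, LinearMap.neg_comp]

end Calculus

/-! ### Nested and parallel products; the axioms with one variable per argument -/

section Atoms

variable {k : Type*} [Field k] {P : Type*} [AddCommGroup P] [Module k P]
variable {W' : Type*} [AddCommGroup W'] [Module k W']
variable {W : Type*} [AddCommGroup W] [Module k W]

/-- `f(a_S, g(b_T, c))`, embedded by `φ`. -/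
def nest (φ : P →ₗ[k] W) (f g : P →ₗ[k] P →ₗ[k] Pol P) (S T : Module.End k W) (a b c : P) : W :=
  subst T (subst S φ ∘ₗ f a) (g b c)

/-- `f(a_S, x) ⊗ g(b_T, y)`, embedded by `ψ`. -/
def pair (ψ : P →ₗ[k] P →ₗ[k] W) (f g : P →ₗ[k] P →ₗ[k] Pol P) (S T : Module.End k W)
    (a x b y : P) : W :=
  subst S ((substHom P T).flip (g b y) ∘ₗ ψ) (f a x)

/-- `f(a, b)_λ = ε f(b, a)_{-λ-∂}`. -/
def IsSigned (ε : k) (D : Module.End k P) (f : P →ₗ[k] P →ₗ[k] Pol P) : Prop :=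
  ∀ a b, f a b = ε • negSubst D (f b a)

theorem map_nest {F : W →ₗ[k] W'} {S T : Module.End k W} {S' T' : Module.End k W'}
    (hS : F ∘ₗ S = S' ∘ₗ F) (hT : F ∘ₗ T = T' ∘ₗ F) (φ : P →ₗ[k] W)
    (f g : P →ₗ[k] P →ₗ[k] Pol P) (a b c : P) :
    F (nest φ f g S T a b c) = nest (F ∘ₗ φ) f g S' T' a b c := by
  rw [nest, map_subst hT, nest]
  congr 1
  congr 1
  ext1 z
  simp only [LinearMap.comp_apply, map_subst hS]

theorem map_pair {F : W →ₗ[k] W'} {S T : Module.End k W} {S' T' : Module.End k W'}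
    (hS : F ∘ₗ S = S' ∘ₗ F) (hT : F ∘ₗ T = T' ∘ₗ F) (ψ : P →ₗ[k] P →ₗ[k] W)
    (f g : P →ₗ[k] P →ₗ[k] Pol P) (a x b y : P) :
    F (pair ψ f g S T a x b y) = pair (ψ.compr₂ F) f g S' T' a x b y := by
  rw [pair, map_subst hS, pair]
  congr 1
  congr 1
  ext1 z
  simp only [LinearMap.comp_apply, LinearMap.flip_apply, substHom_apply, map_subst hT]
  rfl

/-- Both sides are the double sum of Sⁿ Tᵐ applied to the coefficients; only the order of the two
substitutions differs. -/
theorem pair_comm {S T : Module.End k W} (h : Commute S T) (ψ : P →ₗ[k] P →ₗ[k] W)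
    (f g : P →ₗ[k] P →ₗ[k] Pol P) (a x b y : P) :
    pair ψ f g S T a x b y = pair ψ.flip g f T S b y a x := by
  have : ∀ p q : Pol P, subst S ((substHom P T).flip q ∘ₗ ψ) p
      = subst T ((substHom P S).flip p ∘ₗ ψ.flip) q := by
    intro p q
    induction p using Finsupp.induction_linear with
    | zero => simp [← substHom_apply T]
    | add p p' hp hp' =>
      simp only [map_add, hp, hp', LinearMap.add_comp]
      simp only [← substHom_apply T, map_add, LinearMap.add_apply]
    | single n v =>
      rw [subst_single, LinearMap.comp_apply, LinearMap.flip_apply, substHom_apply,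
        map_subst (T' := T) (h.pow_left n).eq]
      congr 1
      congr 1
      ext w
      simp [substHom_apply, subst_single]
  exact this _ _

theorem subst_signed {ε : k} {D : Module.End k P} {f : P →ₗ[k] P →ₗ[k] Pol P}
    (hf : IsSigned ε D f) {φ : P →ₗ[k] W} {S T E : Module.End k W}
    (hφ : φ ∘ₗ D = E ∘ₗ φ) (hT : Commute S E) (h : S + T + E = 0) (a b : P) :
    subst S φ (f a b) = ε • subst T φ (f b a) := by
  rw [hf a b, map_smul, subst_negSubst hφ hT h]

variable {D : Module.End k P} {f g : P →ₗ[k] P →ₗ[k] Pol P}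

/-- Behind `a` with variable T, the inner ∂ is seen as E + T. This is the source of the four-term
conservation law S + T + R + E = 0 for nested products. -/
theorem subst_comp_sesquilinear {T E : Module.End k W} {φ : P →ₗ[k] W}
    (hf : IsSesquilinear D f) (hφ : φ ∘ₗ D = E ∘ₗ φ) (hT : Commute T E) (a : P) :
    (subst T φ ∘ₗ f a) ∘ₗ D = (E + T) ∘ₗ (subst T φ ∘ₗ f a) := by
  ext1 z
  have := LinearMap.congr_fun (subst_comp_coeffwise hφ hT) (f a z)
  simp only [LinearMap.comp_apply] at this
  simp [hf.right, subst_lam, this]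

/-- `f(a, g(b, c)) = ε f(a, g(c, b))`. -/
theorem nest_swap {ε : k} (hf : IsSesquilinear D f) (hg : IsSigned ε D g) {φ : P →ₗ[k] W}
    {S T R E : Module.End k W} (hφ : φ ∘ₗ D = E ∘ₗ φ) (hSE : Commute S E) (hTE : Commute T E)
    (hST : Commute S T) (h : S + T + R + E = 0) (a b c : P) :
    nest φ f g S T a b c = ε • nest φ f g S R a c b := by
  refine subst_signed hg (subst_comp_sesquilinear hf hφ hSE a) (hTE.add_right hST.symm) ?_ b c
  rw [← h]; abel

/-- `f(g(a, b), c) = ε f(c, g(a, b))`. -/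
theorem subst_flip_eq_nest {ε : k} (hf : IsSigned ε D f) {φ : P →ₗ[k] W}
    {S Z R E : Module.End k W} (hφ : φ ∘ₗ D = E ∘ₗ φ) (hZE : Commute Z E) (h : Z + R + E = 0)
    (a b c : P) :
    subst S (subst Z φ ∘ₗ f.flip c) (g a b) = ε • nest φ f g R S c a b := by
  have : subst Z φ ∘ₗ f.flip c = ε • (subst R φ ∘ₗ f c) := by
    ext1 z
    exact subst_signed hf hφ hZE h z c
  rw [this, ← substHom_apply, map_smul]
  rfl

section Eval2

variable {S T : Module.End k W} (φ : P →ₗ[k] W)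

/-- The outer variable of `Pol (Pol P)` is μ and the inner one is λ, so `subst T (subst S φ)`
evaluates at λ = S, μ = T. The lemmas of this section carry the two-variable axioms over to
identities between nested products; `S` and `T` have to commute as λ and μ do. -/
theorem eval₂_comp_subst_mu2 :
    subst T (subst S φ) ∘ₗ subst (mu2 k P) (const2 k P) = subst T φ := by
  refine LinearMap.ext fun p => ?_
  rw [LinearMap.comp_apply, mu2, map_subst (subst_comp_lam T _)]
  congr 2
  rw [const2, ← LinearMap.comp_assoc, subst_comp_const, subst_comp_const]

theorem eval₂_comp_lam2 (h : Commute S T) :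
    subst T (subst S φ) ∘ₗ lam2 k P = S ∘ₗ subst T (subst S φ) :=
  subst_comp_coeffwise (subst_comp_lam S φ) h.symm

theorem eval₂_comp_subst_lam2 (h : Commute S T) :
    subst T (subst S φ) ∘ₗ subst (lam2 k P) (const2 k P) = subst S φ := by
  refine LinearMap.ext fun p => ?_
  rw [LinearMap.comp_apply, map_subst (eval₂_comp_lam2 φ h)]
  congr 2
  rw [const2, ← LinearMap.comp_assoc, subst_comp_const, subst_comp_const]

theorem eval₂_comp_subst_lam2_add_mu2 (h : Commute S T) :
    subst T (subst S φ) ∘ₗ subst (lam2 k P + mu2 k P) (const2 k P) = subst (S + T) φ := by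
  refine LinearMap.ext fun p => ?_
  rw [LinearMap.comp_apply, map_subst (T' := S + T)]
  · congr 2
    rw [const2, ← LinearMap.comp_assoc, subst_comp_const, subst_comp_const]
  · rw [LinearMap.comp_add, eval₂_comp_lam2 φ h, mu2, subst_comp_lam, LinearMap.add_comp]

theorem eval₂_nestL (h : Commute S T) (a b c : P) :
    subst T (subst S φ) (nestL f g a b c) = nest φ f g S T a b c := by
  rw [nestL, mu2, map_subst (subst_comp_lam T _), ← LinearMap.comp_assoc,
    eval₂_comp_subst_lam2 φ h, nest]

theorem eval₂_nestM (h : Commute S T) (a b c : P) :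
    subst T (subst S φ) (nestM f g b a c) = nest φ f g T S b a c := by
  rw [nestM, map_subst (eval₂_comp_lam2 φ h), ← LinearMap.comp_assoc,
    eval₂_comp_subst_mu2, nest]

theorem eval₂_nestLM (h : Commute S T) (a b c : P) :
    subst T (subst S φ) (nestLM f g a b c) = subst S (subst (S + T) φ ∘ₗ g.flip c) (f a b) := by
  rw [nestLM, map_subst (eval₂_comp_lam2 φ h), ← LinearMap.comp_assoc,
    eval₂_comp_subst_lam2_add_mu2 φ h]

end Eval2

variable {br m : P →ₗ[k] P →ₗ[k] Pol P}

theorem IsLieConformalAlgebra.isSigned (h : IsLieConformalAlgebra D br) :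
    IsSigned (-1) D br := fun a b => by
  rw [neg_one_smul]; exact h.skew a b

theorem IsCommutative.isSigned (h : IsCommutative D m) : IsSigned 1 D m := fun a b => by
  rw [one_smul]; exact h a b

variable {φ : P →ₗ[k] W} {S T R E : Module.End k W}

/-- `f(a, g(b, c)) = f(b, g(a, c)) - f(c, g(a, b))` for `f = g` a Lie bracket. -/
theorem nest_jacobi (hL : IsLieConformalAlgebra D br) (hφ : φ ∘ₗ D = E ∘ₗ φ)
    (hSE : Commute S E) (hTE : Commute T E) (hST : Commute S T) (h : S + T + R + E = 0)
    (a b c : P) :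
    nest φ br br S T a b c = nest φ br br T S b a c - nest φ br br R S c a b := by
  have := congrArg (subst T (subst S φ)) (hL.jacobi a b c)
  rw [map_add, eval₂_nestL φ hST, eval₂_nestM φ hST, eval₂_nestLM φ hST,
    subst_flip_eq_nest hL.isSigned hφ (hSE.add_left hTE) h] at this
  rw [this]; module

/-- `[a, b c] = b [a, c] + c [a, b]`. -/
theorem nest_leibniz (hP : IsPoissonConformalAlgebra D br m) (hφ : φ ∘ₗ D = E ∘ₗ φ)
    (hSE : Commute S E) (hTE : Commute T E) (hST : Commute S T) (h : S + T + R + E = 0)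
    (a b c : P) :
    nest φ br m S T a b c = nest φ m br T S b a c + nest φ m br R S c a b := by
  have := congrArg (subst T (subst S φ)) (hP.leibniz a b c)
  rw [map_add, eval₂_nestL φ hST, eval₂_nestM φ hST, eval₂_nestLM φ hST,
    subst_flip_eq_nest hP.comm.isSigned hφ (hSE.add_left hTE) h] at this
  rw [this]; module

/-- `a (b c) = c (a b)`. -/
theorem nest_assoc (hP : IsPoissonConformalAlgebra D br m) (hφ : φ ∘ₗ D = E ∘ₗ φ)
    (hSE : Commute S E) (hTE : Commute T E) (hST : Commute S T) (h : S + T + R + E = 0)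
    (a b c : P) :
    nest φ m m S T a b c = nest φ m m R S c a b := by
  have := congrArg (subst T (subst S φ)) (hP.assoc.assoc a b c)
  rw [eval₂_nestL φ hST, eval₂_nestLM φ hST,
    subst_flip_eq_nest hP.comm.isSigned hφ (hSE.add_left hTE) h] at this
  rw [← this]; module

end Atoms

/-! ### The three tensor slots and their derivations -/

section Slots

variable {k : Type*} [Field k]
variable {V : Type*} [AddCommGroup V] [Module k V]
variable {U : Type*} [AddCommGroup U] [Module k U]

theorem onLeft_tmul (g : V →ₗ[k] Pol V) (v : V) (u : U) :
    onLeft U g (v ⊗ₜ[k] u) = coeffwise ((TensorProduct.mk k V U).flip u) (g v) := by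
  simp only [onLeft, LinearMap.comp_apply, LinearMap.rTensor_tmul, LinearEquiv.coe_coe]
  induction g v using Finsupp.induction_linear with
  | zero => simp
  | add p q hp hq => simp only [TensorProduct.add_tmul, map_add, hp, hq]
  | single n w =>
    rw [coeffwise_single, TensorProduct.finsuppLeft_apply_tmul]
    simp

theorem onRight_tmul (g : U →ₗ[k] Pol U) (v : V) (u : U) :
    onRight V g (v ⊗ₜ[k] u) = coeffwise (TensorProduct.mk k V U v) (g u) := by
  simp only [onRight, LinearMap.comp_apply, LinearMap.lTensor_tmul, LinearEquiv.coe_coe]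
  induction g u using Finsupp.induction_linear with
  | zero => simp
  | add p q hp hq => simp only [TensorProduct.tmul_add, map_add, hp, hq]
  | single n w =>
    rw [coeffwise_single, TensorProduct.finsuppRight_apply_tmul]
    simp

variable {P : Type*} [AddCommGroup P] [Module k P]

theorem evalAt_onA_tmul (Z : Module.End k (P ⊗[k] (P ⊗[k] P))) (g : P →ₗ[k] Pol P) (z u v : P) :
    evalAt Z (onA g (z ⊗ₜ[k] (u ⊗ₜ[k] v))) = subst Z (insA u v) (g z) := by
  rw [onA, onLeft_tmul, evalAt_coeffwise, insA]

theorem evalAt_onB_tmul (Z : Module.End k (P ⊗[k] (P ⊗[k] P))) (g : P →ₗ[k] Pol P) (z u v : P) :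
    evalAt Z (onB g (u ⊗ₜ[k] (z ⊗ₜ[k] v))) = subst Z (insB u v) (g z) := by
  rw [onB, onRight_tmul, onLeft_tmul, evalAt_coeffwise, subst_coeffwise, insB]

theorem evalAt_onC_tmul (Z : Module.End k (P ⊗[k] (P ⊗[k] P))) (g : P →ₗ[k] Pol P) (z u v : P) :
    evalAt Z (onC g (u ⊗ₜ[k] (v ⊗ₜ[k] z))) = subst Z (insC u v) (g z) := by
  rw [onC, onRight_tmul, onRight_tmul, evalAt_coeffwise, subst_coeffwise, insC]

/-- Two maps out of `P ⊗ P ⊗ P` that agree on pure tensors are equal. -/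
theorem ext₃ {W : Type*} [AddCommGroup W] [Module k W] {F G : P ⊗[k] (P ⊗[k] P) →ₗ[k] W}
    (h : ∀ u v w, F (u ⊗ₜ[k] (v ⊗ₜ[k] w)) = G (u ⊗ₜ[k] (v ⊗ₜ[k] w))) : F = G := by
  ext u v w
  exact h u v w

variable (D : Module.End k P)

theorem insA_comp (u v : P) : insA u v ∘ₗ D = delA D ∘ₗ insA u v := by
  ext z; simp [insA, delA]

theorem insB_comp (u v : P) : insB u v ∘ₗ D = delB D ∘ₗ insB u v := by
  ext z; simp [insB, delB]

theorem insC_comp (u v : P) : insC u v ∘ₗ D = delC D ∘ₗ insC u v := by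
  ext z; simp [insC, delC]

theorem delB_comp_insA (u v : P) : delB D ∘ₗ insA u v = insA (D u) v := by
  ext z; simp [insA, delB]

theorem delC_comp_insA (u v : P) : delC D ∘ₗ insA u v = insA u (D v) := by
  ext z; simp [insA, delC]

theorem delA_comp_insB (u v : P) : delA D ∘ₗ insB u v = insB (D u) v := by
  ext z; simp [insB, delA]

theorem delC_comp_insB (u v : P) : delC D ∘ₗ insB u v = insB u (D v) := by
  ext z; simp [insB, delC]

theorem delA_comp_insC (u v : P) : delA D ∘ₗ insC u v = insC (D u) v := by
  ext z; simp [insC, delA]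

theorem delB_comp_insC (u v : P) : delB D ∘ₗ insC u v = insC u (D v) := by
  ext z; simp [insC, delB]

theorem commute_delA_delB : Commute (delA D) (delB D) :=
  ext₃ fun u v w => by simp [delA, delB]

theorem commute_delA_delC : Commute (delA D) (delC D) :=
  ext₃ fun u v w => by simp [delA, delC]

theorem commute_delB_delC : Commute (delB D) (delC D) :=
  ext₃ fun u v w => by simp [delB, delC]

theorem commute_del3_delA : Commute (-del3 D) (delA D) :=
  (((Commute.refl _).add_left (commute_delA_delB D).symm).add_left
    (commute_delA_delC D).symm).neg_left

theorem commute_del3_delB : Commute (-del3 D) (delB D) :=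
  (((commute_delA_delB D).add_left (Commute.refl _)).add_left
    (commute_delB_delC D).symm).neg_left

theorem commute_del3_delC : Commute (-del3 D) (delC D) :=
  (((commute_delA_delC D).add_left (commute_delB_delC D)).add_left (Commute.refl _)).neg_left

end Slots

/-! ### Actions of the algebra on one slot -/

section Actions

variable {k : Type*} [Field k] {P : Type*} [AddCommGroup P] [Module k P]
variable {D : Module.End k P} {f g : P →ₗ[k] P →ₗ[k] Pol P}
variable {Z : Module.End k (P ⊗[k] (P ⊗[k] P))}

/-- `g_λ ⊗ I ⊗ I` at `λ = Z`. -/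
def actA (Z : Module.End k (P ⊗[k] (P ⊗[k] P))) (g : P →ₗ[k] Pol P) :
    Module.End k (P ⊗[k] (P ⊗[k] P)) := evalAt Z ∘ₗ onA g

/-- `I ⊗ g_λ ⊗ I` at `λ = Z`. -/
def actB (Z : Module.End k (P ⊗[k] (P ⊗[k] P))) (g : P →ₗ[k] Pol P) :
    Module.End k (P ⊗[k] (P ⊗[k] P)) := evalAt Z ∘ₗ onB g

/-- `I ⊗ I ⊗ g_λ` at `λ = Z`. -/
def actC (Z : Module.End k (P ⊗[k] (P ⊗[k] P))) (g : P →ₗ[k] Pol P) :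
    Module.End k (P ⊗[k] (P ⊗[k] P)) := evalAt Z ∘ₗ onC g

theorem actA_tmul (g : P →ₗ[k] Pol P) (z u v : P) :
    actA Z g (z ⊗ₜ[k] (u ⊗ₜ[k] v)) = subst Z (insA u v) (g z) :=
  evalAt_onA_tmul Z g z u v

theorem actB_tmul (g : P →ₗ[k] Pol P) (z u v : P) :
    actB Z g (u ⊗ₜ[k] (z ⊗ₜ[k] v)) = subst Z (insB u v) (g z) :=
  evalAt_onB_tmul Z g z u v

theorem actC_tmul (g : P →ₗ[k] Pol P) (z u v : P) :
    actC Z g (u ⊗ₜ[k] (v ⊗ₜ[k] z)) = subst Z (insC u v) (g z) :=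
  evalAt_onC_tmul Z g z u v

theorem actA_comp_delA (hf : IsSesquilinear D f) (a : P) (hZ : Commute Z (delA D)) :
    actA Z (f a) ∘ₗ delA D = (delA D + Z) ∘ₗ actA Z (f a) := by
  refine ext₃ fun u v w => ?_
  have := LinearMap.congr_fun (subst_comp_sesquilinear hf (insA_comp D v w) hZ a) u
  rw [LinearMap.comp_apply, LinearMap.comp_apply, actA_tmul, delA, LinearMap.rTensor_tmul,
    actA_tmul]
  exact this

theorem actB_comp_delB (hf : IsSesquilinear D f) (a : P) (hZ : Commute Z (delB D)) :
    actB Z (f a) ∘ₗ delB D = (delB D + Z) ∘ₗ actB Z (f a) := by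
  refine ext₃ fun u v w => ?_
  have := LinearMap.congr_fun (subst_comp_sesquilinear hf (insB_comp D u w) hZ a) v
  rw [LinearMap.comp_apply, LinearMap.comp_apply, actB_tmul, delB, LinearMap.lTensor_tmul,
    LinearMap.rTensor_tmul, actB_tmul]
  exact this

theorem actC_comp_delC (hf : IsSesquilinear D f) (a : P) (hZ : Commute Z (delC D)) :
    actC Z (f a) ∘ₗ delC D = (delC D + Z) ∘ₗ actC Z (f a) := by
  refine ext₃ fun u v w => ?_
  have := LinearMap.congr_fun (subst_comp_sesquilinear hf (insC_comp D u v) hZ a) w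
  rw [LinearMap.comp_apply, LinearMap.comp_apply, actC_tmul, delC, LinearMap.lTensor_tmul,
    LinearMap.lTensor_tmul, actC_tmul]
  exact this

variable (g : P →ₗ[k] Pol P)

theorem actA_comp_delB (hZ : Commute Z (delB D)) :
    actA Z g ∘ₗ delB D = delB D ∘ₗ actA Z g := by
  refine ext₃ fun u v w => ?_
  rw [LinearMap.comp_apply, LinearMap.comp_apply, actA_tmul, map_subst hZ.symm.eq,
    delB_comp_insA, ← actA_tmul]
  rfl

theorem actA_comp_delC (hZ : Commute Z (delC D)) :
    actA Z g ∘ₗ delC D = delC D ∘ₗ actA Z g := by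
  refine ext₃ fun u v w => ?_
  rw [LinearMap.comp_apply, LinearMap.comp_apply, actA_tmul, map_subst hZ.symm.eq,
    delC_comp_insA, ← actA_tmul]
  rfl

theorem actB_comp_delA (hZ : Commute Z (delA D)) :
    actB Z g ∘ₗ delA D = delA D ∘ₗ actB Z g := by
  refine ext₃ fun u v w => ?_
  rw [LinearMap.comp_apply, LinearMap.comp_apply, actB_tmul, map_subst hZ.symm.eq,
    delA_comp_insB, ← actB_tmul]
  rfl

theorem actB_comp_delC (hZ : Commute Z (delC D)) :
    actB Z g ∘ₗ delC D = delC D ∘ₗ actB Z g := by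
  refine ext₃ fun u v w => ?_
  rw [LinearMap.comp_apply, LinearMap.comp_apply, actB_tmul, map_subst hZ.symm.eq,
    delC_comp_insB, ← actB_tmul]
  rfl

theorem actC_comp_delA (hZ : Commute Z (delA D)) :
    actC Z g ∘ₗ delA D = delA D ∘ₗ actC Z g := by
  refine ext₃ fun u v w => ?_
  rw [LinearMap.comp_apply, LinearMap.comp_apply, actC_tmul, map_subst hZ.symm.eq,
    delA_comp_insC, ← actC_tmul]
  rfl

theorem actC_comp_delB (hZ : Commute Z (delB D)) :
    actC Z g ∘ₗ delB D = delB D ∘ₗ actC Z g := by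
  refine ext₃ fun u v w => ?_
  rw [LinearMap.comp_apply, LinearMap.comp_apply, actC_tmul, map_subst hZ.symm.eq,
    delB_comp_insC, ← actC_tmul]
  rfl

end Actions

/-! ### The common shape of [[r, r]] and r • r, and the actions on it -/

section YangBaxter

variable {k : Type*} [Field k] {P : Type*} [AddCommGroup P] [Module k P]
variable {D : Module.End k P} {f g : P →ₗ[k] P →ₗ[k] Pol P}

/-- `z ↦ w ↦ z ⊗ w ⊗ s`. -/
def insAB (s : P) : P →ₗ[k] P →ₗ[k] P ⊗[k] (P ⊗[k] P) :=
  (TensorProduct.mk k P (P ⊗[k] P)).compl₂ ((TensorProduct.mk k P P).flip s)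

/-- `z ↦ w ↦ z ⊗ s ⊗ w`. -/
def insAC (s : P) : P →ₗ[k] P →ₗ[k] P ⊗[k] (P ⊗[k] P) :=
  (TensorProduct.mk k P (P ⊗[k] P)).compl₂ (TensorProduct.mk k P P s)

/-- `z ↦ w ↦ s ⊗ z ⊗ w`. -/
def insBC (s : P) : P →ₗ[k] P →ₗ[k] P ⊗[k] (P ⊗[k] P) :=
  (TensorProduct.mk k P P).compr₂ (TensorProduct.mk k P (P ⊗[k] P) s)

/-- By sesquilinearity the action adds its variable to the derivation of its own slot and leaves the
others alone, so ∂^{⊗3} becomes ∂^{⊗3} + Z, which is zero at Z = -∂^{⊗3}. -/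
theorem del3_eq_zero_of_actA (hf : IsSesquilinear D f) (a : P) :
    actA (-del3 D) (f a) ∘ₗ del3 D = 0 := by
  rw [del3, LinearMap.comp_add, LinearMap.comp_add, ← del3,
    actA_comp_delA hf a (commute_del3_delA D), actA_comp_delB _ (commute_del3_delB D),
    actA_comp_delC _ (commute_del3_delC D), ← LinearMap.add_comp, ← LinearMap.add_comp, del3]
  rw [show ∀ T : Module.End k (P ⊗[k] (P ⊗[k] P)), T = 0 → T ∘ₗ _ = 0 from
    fun T h => by rw [h, LinearMap.zero_comp]]
  abel

theorem del3_eq_zero_of_actB (hf : IsSesquilinear D f) (a : P) :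
    actB (-del3 D) (f a) ∘ₗ del3 D = 0 := by
  rw [del3, LinearMap.comp_add, LinearMap.comp_add, ← del3,
    actB_comp_delB hf a (commute_del3_delB D), actB_comp_delA _ (commute_del3_delA D),
    actB_comp_delC _ (commute_del3_delC D), ← LinearMap.add_comp, ← LinearMap.add_comp, del3]
  rw [show ∀ T : Module.End k (P ⊗[k] (P ⊗[k] P)), T = 0 → T ∘ₗ _ = 0 from
    fun T h => by rw [h, LinearMap.zero_comp]]
  abel

theorem del3_eq_zero_of_actC (hf : IsSesquilinear D f) (a : P) :
    actC (-del3 D) (f a) ∘ₗ del3 D = 0 := by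
  rw [del3, LinearMap.comp_add, LinearMap.comp_add, ← del3,
    actC_comp_delC hf a (commute_del3_delC D), actC_comp_delA _ (commute_del3_delA D),
    actC_comp_delB _ (commute_del3_delB D), ← LinearMap.add_comp, ← LinearMap.add_comp, del3]
  rw [show ∀ T : Module.End k (P ⊗[k] (P ⊗[k] P)), T = 0 → T ∘ₗ _ = 0 from
    fun T h => by rw [h, LinearMap.zero_comp]]
  abel

/-- `g(x, x') ⊗ y ⊗ y' - x ⊗ g(x', y) ⊗ y' + x ⊗ x' ⊗ g(y, y')`, the last two products
being shifted by a multiple of `∂^{⊗3}`. -/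
def yb (D : Module.End k P) (g : P →ₗ[k] P →ₗ[k] Pol P) (c d : k) (x y x' y' : P) :
    P ⊗[k] (P ⊗[k] P) :=
  subst (delB D) (insA y y') (g x x') - subst (delC D - c • del3 D) (insB x y') (g x' y)
    + subst (delA D - d • del3 D) (insC x x') (g y y')

/-- An action at λ = -∂^{⊗3} sees the inner variable only modulo ∂^{⊗3}. For this reason the
different normalisations of μ in [[r, r]] and r • r play no role. -/
theorem map_subst_shift {F S T : Module.End k (P ⊗[k] (P ⊗[k] P))} (hF : F ∘ₗ del3 D = 0)
    (h : F ∘ₗ T = S ∘ₗ F) (c : k) (φ : P →ₗ[k] P ⊗[k] (P ⊗[k] P)) (p : Pol P) :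
    F (subst (T - c • del3 D) φ p) = subst S (F ∘ₗ φ) p := by
  apply map_subst
  rw [LinearMap.comp_sub, LinearMap.comp_smul, hF, smul_zero, sub_zero, h]

theorem actA_comp_insA (Z : Module.End k (P ⊗[k] (P ⊗[k] P))) (g : P →ₗ[k] Pol P) (u v : P) :
    actA Z g ∘ₗ insA u v = subst Z (insA u v) ∘ₗ g :=
  LinearMap.ext fun z => actA_tmul g z u v

theorem actB_comp_insB (Z : Module.End k (P ⊗[k] (P ⊗[k] P))) (g : P →ₗ[k] Pol P) (u v : P) :
    actB Z g ∘ₗ insB u v = subst Z (insB u v) ∘ₗ g :=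
  LinearMap.ext fun z => actB_tmul g z u v

theorem actC_comp_insC (Z : Module.End k (P ⊗[k] (P ⊗[k] P))) (g : P →ₗ[k] Pol P) (u v : P) :
    actC Z g ∘ₗ insC u v = subst Z (insC u v) ∘ₗ g :=
  LinearMap.ext fun z => actC_tmul g z u v

theorem actA_comp_insB (Z : Module.End k (P ⊗[k] (P ⊗[k] P))) (g : P →ₗ[k] Pol P) (u v : P) :
    actA Z g ∘ₗ insB u v = (substHom P Z).flip (g u) ∘ₗ (insAB v).flip :=
  LinearMap.ext fun z => actA_tmul g u z v

theorem actA_comp_insC (Z : Module.End k (P ⊗[k] (P ⊗[k] P))) (g : P →ₗ[k] Pol P) (u v : P) :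
    actA Z g ∘ₗ insC u v = (substHom P Z).flip (g u) ∘ₗ (insAC v).flip :=
  LinearMap.ext fun z => actA_tmul g u v z

theorem actB_comp_insA (Z : Module.End k (P ⊗[k] (P ⊗[k] P))) (g : P →ₗ[k] Pol P) (u v : P) :
    actB Z g ∘ₗ insA u v = (substHom P Z).flip (g u) ∘ₗ insAB v :=
  LinearMap.ext fun z => actB_tmul g u z v

theorem actB_comp_insC (Z : Module.End k (P ⊗[k] (P ⊗[k] P))) (g : P →ₗ[k] Pol P) (u v : P) :
    actB Z g ∘ₗ insC u v = (substHom P Z).flip (g v) ∘ₗ (insBC u).flip :=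
  LinearMap.ext fun z => actB_tmul g v u z

theorem actC_comp_insA (Z : Module.End k (P ⊗[k] (P ⊗[k] P))) (g : P →ₗ[k] Pol P) (u v : P) :
    actC Z g ∘ₗ insA u v = (substHom P Z).flip (g v) ∘ₗ insAC u :=
  LinearMap.ext fun z => actC_tmul g v z u

theorem actC_comp_insB (Z : Module.End k (P ⊗[k] (P ⊗[k] P))) (g : P →ₗ[k] Pol P) (u v : P) :
    actC Z g ∘ₗ insB u v = (substHom P Z).flip (g v) ∘ₗ insBC u :=
  LinearMap.ext fun z => actC_tmul g v u z

theorem subst_eq_pair {W : Type*} [AddCommGroup W] [Module k W] {S Z : Module.End k W}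
    (h : Commute S Z) (ψ : P →ₗ[k] P →ₗ[k] W) (a x b y : P) :
    subst S ((substHom P Z).flip (f a x) ∘ₗ ψ) (g b y) = pair ψ.flip f g Z S a x b y :=
  pair_comm h ψ g f b y a x

/-- `f(a, x) ⊗ g(b, y) = ε f(a, x) ⊗ g(y, b)`. -/
theorem pair_swap {W : Type*} [AddCommGroup W] [Module k W] {ε : k} (hg : IsSigned ε D g)
    {S T R E : Module.End k W} {ψ : P →ₗ[k] P →ₗ[k] W} (hψ : ∀ z, ψ z ∘ₗ D = E ∘ₗ ψ z)
    (hTE : Commute T E) (h : T + R + E = 0) (a x b y : P) :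
    pair ψ f g S T a x b y = ε • pair ψ f g S R a x y b := by
  have : (substHom P T).flip (g b y) ∘ₗ ψ = ε • ((substHom P R).flip (g y b) ∘ₗ ψ) :=
    LinearMap.ext fun z => subst_signed hg (hψ z) hTE h b y
  rw [pair, this, ← substHom_apply, map_smul]
  rfl

variable {ε : k}

/-- In `yb` each leg carries, modulo ∂^{⊗3}, the derivation of the slot of its partner. When `a`
acts on the slot of `x`, that derivation moves by -∂^{⊗3}, and the variable of `y` is no longer a
single derivation; exchanging `y` and `y'` restores the normal form, at the price of the sign `ε`.
-/
theorem actA_yb (hf : IsSesquilinear D f) (hg : IsSigned ε D g) (c d : k) (a x y x' y' : P) :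
    actA (-del3 D) (f a) (yb D g c d x y x' y')
      = nest (insA y y') f g (-del3 D) (delB D) a x x'
        - pair (insAB y') f g (-del3 D) (delC D) a x x' y
        + ε • pair (insAC x') f g (-del3 D) (delB D) a x y' y := by
  have h0 := del3_eq_zero_of_actA hf a
  have hA := commute_del3_delA D
  have hB := commute_del3_delB D
  have hC := commute_del3_delC D
  rw [yb, map_add, map_sub, map_subst (actA_comp_delB (f a) hB),
    map_subst_shift h0 (actA_comp_delC (f a) hC), map_subst_shift h0 (actA_comp_delA hf a hA),
    actA_comp_insA, actA_comp_insB, actA_comp_insC, subst_eq_pair hC.symm,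
    subst_eq_pair (hA.symm.add_left (Commute.refl _)),
    pair_swap (R := delB D) hg (fun z => insC_comp D z x')
      ((commute_delA_delC D).add_left hC) (by rw [del3]; abel)]
  rfl

theorem actB_yb (hf : IsSesquilinear D f) (hg : IsSigned ε D g) (c d : k) (a x y x' y' : P) :
    actB (-del3 D) (f a) (yb D g c d x y x' y')
      = ε • pair (insAB y').flip f g (-del3 D) (delC D) a y x' x
        - nest (insB x y') f g (-del3 D) (delC D) a x' y
        + pair (insBC x) f g (-del3 D) (delA D) a x' y y' := by
  have h0 := del3_eq_zero_of_actB hf a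
  have hA := commute_del3_delA D
  have hB := commute_del3_delB D
  have hC := commute_del3_delC D
  rw [yb, map_add, map_sub, map_subst (actB_comp_delB hf a hB),
    map_subst_shift h0 (actB_comp_delC (f a) hC), map_subst_shift h0 (actB_comp_delA (f a) hA),
    actB_comp_insA, actB_comp_insB, actB_comp_insC, subst_eq_pair hA.symm,
    subst_eq_pair (hB.symm.add_left (Commute.refl _)),
    pair_swap (R := delC D) hg (fun z => insA_comp D z y')
      ((commute_delA_delB D).symm.add_left hA) (by rw [del3]; abel)]
  rfl

theorem actC_yb (hf : IsSesquilinear D f) (hg : IsSigned ε D g) (c d : k) (a x y x' y' : P) :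
    actC (-del3 D) (f a) (yb D g c d x y x' y')
      = pair (insAC y).flip f g (-del3 D) (delB D) a y' x x'
        - ε • pair (insBC x).flip f g (-del3 D) (delA D) a y' y x'
        + nest (insC x x') f g (-del3 D) (delA D) a y y' := by
  have h0 := del3_eq_zero_of_actC hf a
  have hA := commute_del3_delA D
  have hB := commute_del3_delB D
  have hC := commute_del3_delC D
  rw [yb, map_add, map_sub, map_subst (actC_comp_delB (f a) hB),
    map_subst_shift h0 (actC_comp_delC hf a hC), map_subst_shift h0 (actC_comp_delA (f a) hA),
    actC_comp_insA, actC_comp_insB, actC_comp_insC, subst_eq_pair hB.symm,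
    subst_eq_pair (hC.symm.add_left (Commute.refl _)),
    pair_swap (R := delA D) hg (fun z => insB_comp D x z)
      ((commute_delB_delC D).symm.add_left hB) (by rw [del3]; abel)]
  rfl

end YangBaxter

/-! ### [[r, r]] and r • r in the common shape -/

section YangBaxterSums

variable {k : Type*} [Field k] {P : Type*} [AddCommGroup P] [Module k P]
variable {D : Module.End k P} {br m : P →ₗ[k] P →ₗ[k] Pol P} {ι : Type*} [Fintype ι]

/-- Skew-symmetry turns the last bracket around, and its new first argument gets the variable
-(I⊗∂⊗I) - (I⊗I⊗∂), which is ∂⊗I⊗I - ∂^{⊗3}. This is the shift d = 1. -/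
theorem cybe_eq_sum (h : IsLieConformalAlgebra D br) (x y : ι → P) :
    cybe D br x y = ∑ i, ∑ j, yb D br 0 1 (x i) (y i) (x j) (y j) := by
  refine Finset.sum_congr rfl fun i _ => Finset.sum_congr rfl fun j _ => ?_
  rw [yb, zero_smul, sub_zero, one_smul, subst_signed (T := delA D - del3 D) h.isSigned
    (insC_comp D (x i) (x j)) (commute_delB_delC D) (by rw [del3]; abel)]
  module

/-- Here it is the middle term that is shifted: -∂^{⊗2} ⊗ I is I⊗I⊗∂ - ∂^{⊗3}. -/
theorem aybe_eq_sum (x y : ι → P) :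
    aybe D m x y = ∑ i, ∑ j, yb D m 1 0 (x i) (y i) (x j) (y j) := by
  refine Finset.sum_congr rfl fun i _ => Finset.sum_congr rfl fun j _ => ?_
  have : delC D - del3 D = -(delA D + delB D) := by rw [del3]; abel
  rw [yb, zero_smul, sub_zero, one_smul, this]
  abel

end YangBaxterSums

/-! ### The coboundary maps of a pure tensor -/

section HalfCoboundaries

variable {k : Type*} [Field k] {P : Type*} [AddCommGroup P] [Module k P]

/-- `a ↦ f(a, x) ⊗ y`, the formal variable being `-∂^{⊗2}`. -/
def coL (D : Module.End k P) (f : P →ₗ[k] P →ₗ[k] Pol P) (x y : P) : P →ₗ[k] P ⊗[k] P :=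
  subst (-del2 D) ((TensorProduct.mk k P P).flip y) ∘ₗ f.flip x

/-- `a ↦ x ⊗ f(a, y)`, the formal variable being `-∂^{⊗2}`. -/
def coR (D : Module.End k P) (f : P →ₗ[k] P →ₗ[k] Pol P) (x y : P) : P →ₗ[k] P ⊗[k] P :=
  subst (-del2 D) (TensorProduct.mk k P P x) ∘ₗ f.flip y

variable {D : Module.End k P} {f g : P →ₗ[k] P →ₗ[k] Pol P}

theorem evalAt_onLeft_tmul (a x y : P) :
    evalAt (-del2 D) (onLeft P (f a) (x ⊗ₜ[k] y)) = coL D f x y a := by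
  rw [onLeft_tmul, evalAt_coeffwise]; rfl

theorem evalAt_onRight_tmul (a x y : P) :
    evalAt (-del2 D) (onRight P (f a) (x ⊗ₜ[k] y)) = coR D f x y a := by
  rw [onRight_tmul, evalAt_coeffwise]; rfl

theorem coboundaryLie_eq_sum {ι : Type*} [Fintype ι] (D : Module.End k P)
    (br : P →ₗ[k] P →ₗ[k] Pol P) (x y : ι → P) :
    coboundaryLie D br (∑ i, x i ⊗ₜ[k] y i)
      = ∑ i, (coL D br (x i) (y i) + coR D br (x i) (y i)) := by
  ext1 a
  rw [LinearMap.sum_apply]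
  change evalAt (-del2 D) ((onLeft P (br a) + onRight P (br a)) _) = _
  simp only [map_sum, LinearMap.add_apply, map_add, evalAt_onLeft_tmul, evalAt_onRight_tmul]

theorem coboundaryAssoc_eq_sum {ι : Type*} [Fintype ι] (D : Module.End k P)
    (m : P →ₗ[k] P →ₗ[k] Pol P) (x y : ι → P) :
    coboundaryAssoc D m (∑ i, x i ⊗ₜ[k] y i)
      = ∑ i, (coR D m (x i) (y i) - coL D m (x i) (y i)) := by
  ext1 a
  rw [LinearMap.sum_apply]
  change evalAt (-del2 D) ((onRight P (m a) - onLeft P (m a)) _) = _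
  simp only [map_sum, LinearMap.sub_apply, map_sub, evalAt_onLeft_tmul, evalAt_onRight_tmul]

theorem coL_equivariant (hf : IsSesquilinear D f) (x y : P) :
    coL D f x y ∘ₗ D = del2 D ∘ₗ coL D f x y := by
  ext1 z; simp [coL, hf.left, subst_lam]

theorem coR_equivariant (hf : IsSesquilinear D f) (x y : P) :
    coR D f x y ∘ₗ D = del2 D ∘ₗ coR D f x y := by
  ext1 z; simp [coR, hf.left, subst_lam]

/-- Equivariance of `G` makes the variable -∂^{⊗2} of the outer coboundary become -∂^{⊗3} after the
second cooperation, which is the variable of `a` in the conditions on [[r, r]] and r • r. -/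
theorem coRight_comp_del2 {G : P →ₗ[k] P ⊗[k] P} (hG : G ∘ₗ D = del2 D ∘ₗ G) :
    coRight G ∘ₗ (-del2 D) = (-del3 D) ∘ₗ coRight G := by
  ext u v
  have := LinearMap.congr_fun hG v
  simp only [LinearMap.comp_apply] at this
  simp [coRight, del2, del3, delA, delB, delC, this, TensorProduct.tmul_add]
  abel

theorem coLeft_comp_del2 {G : P →ₗ[k] P ⊗[k] P} (hG : G ∘ₗ D = del2 D ∘ₗ G) :
    coLeft G ∘ₗ (-del2 D) = (-del3 D) ∘ₗ coLeft G := by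
  have hassoc : (TensorProduct.assoc k P P P).toLinearMap ∘ₗ (del2 D).rTensor P
      = (delA D + delB D) ∘ₗ (TensorProduct.assoc k P P P).toLinearMap := by
    ext u v w
    simp [del2, delA, delB]
  have hassoc' : (TensorProduct.assoc k P P P).toLinearMap ∘ₗ D.lTensor (P ⊗[k] P)
      = delC D ∘ₗ (TensorProduct.assoc k P P P).toLinearMap := by
    ext u v w
    simp [delC]
  ext u v
  have h1 := LinearMap.congr_fun hassoc (G u ⊗ₜ[k] v)
  have h2 := LinearMap.congr_fun hassoc' (G u ⊗ₜ[k] v)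
  have := LinearMap.congr_fun hG u
  simp only [LinearMap.comp_apply] at this
  simp [coLeft, this, del2] at h1 h2 ⊢
  simp [TensorProduct.add_tmul, h1, h2, del3] at h1 h2 ⊢

end HalfCoboundaries

/-! ### Iterated coboundaries in normal form -/

section Iterated

variable {k : Type*} [Field k] {P : Type*} [AddCommGroup P] [Module k P]
variable {D : Module.End k P} {f g : P →ₗ[k] P →ₗ[k] Pol P}

theorem tmul_subst (u : P) {φ : P →ₗ[k] P ⊗[k] P} (p : Pol P) :
    u ⊗ₜ[k] subst (-del2 D) φ p
      = subst (-(delB D + delC D)) (TensorProduct.mk k P (P ⊗[k] P) u ∘ₗ φ) p := by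
  refine map_subst (F := TensorProduct.mk k P (P ⊗[k] P) u) ?_ φ p
  ext v w
  simp [del2, delB, delC, TensorProduct.tmul_add, TensorProduct.tmul_neg]

theorem tensorRight_subst (u : P) {φ : P →ₗ[k] P ⊗[k] P} (p : Pol P) :
    TensorProduct.assoc k P P P (subst (-del2 D) φ p ⊗ₜ[k] u)
      = subst (-(delA D + delB D)) ((TensorProduct.assoc k P P P).toLinearMap ∘ₗ
          (TensorProduct.mk k (P ⊗[k] P) P).flip u ∘ₗ φ) p := by
  refine map_subst (F := (TensorProduct.assoc k P P P).toLinearMap ∘ₗ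
    (TensorProduct.mk k (P ⊗[k] P) P).flip u) ?_ φ p
  ext v w
  simp [del2, delA, delB]

theorem commute_delB_add_delC_delB : Commute (-(delB D + delC D)) (delB D) :=
  ((Commute.refl _).add_left (commute_delB_delC D).symm).neg_left

theorem commute_delB_add_delC_delC : Commute (-(delB D + delC D)) (delC D) :=
  ((commute_delB_delC D).add_left (Commute.refl _)).neg_left

theorem commute_delA_add_delB_delA : Commute (-(delA D + delB D)) (delA D) :=
  ((Commute.refl _).add_left (commute_delA_delB D).symm).neg_left

theorem commute_delA_add_delB_delB : Commute (-(delA D + delB D)) (delB D) :=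
  ((commute_delA_delB D).add_left (Commute.refl _)).neg_left

variable {ε : k}

theorem coRight_coL {G : P →ₗ[k] P ⊗[k] P} (hG : G ∘ₗ D = del2 D ∘ₗ G) (a x y : P) :
    coRight G (coL D f x y a)
      = subst (-del3 D) (coRight G ∘ₗ (TensorProduct.mk k P P).flip y) (f a x) :=
  map_subst (coRight_comp_del2 hG) _ _

theorem coRight_coR {G : P →ₗ[k] P ⊗[k] P} (hG : G ∘ₗ D = del2 D ∘ₗ G) (a x y : P) :
    coRight G (coR D f x y a)
      = subst (-del3 D) (coRight G ∘ₗ TensorProduct.mk k P P x) (f a y) :=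
  map_subst (coRight_comp_del2 hG) _ _

theorem coLeft_coL {G : P →ₗ[k] P ⊗[k] P} (hG : G ∘ₗ D = del2 D ∘ₗ G) (a x y : P) :
    coLeft G (coL D f x y a)
      = subst (-del3 D) (coLeft G ∘ₗ (TensorProduct.mk k P P).flip y) (f a x) :=
  map_subst (coLeft_comp_del2 hG) _ _

theorem coLeft_coR {G : P →ₗ[k] P ⊗[k] P} (hG : G ∘ₗ D = del2 D ∘ₗ G) (a x y : P) :
    coLeft G (coR D f x y a)
      = subst (-del3 D) (coLeft G ∘ₗ TensorProduct.mk k P P x) (f a y) :=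
  map_subst (coLeft_comp_del2 hG) _ _

/-- The inner coboundary evaluates its argument `y` at minus the total derivation of the two slots
it fills. Exchanging `y` and `x'` leaves `x'` with the derivation of the slot of `y'`, its partner.
The other seven combinations follow the same pattern; when `a` and the inner product meet in one
slot, the result is nested. -/
theorem coRight_coL_coL (hg : IsSesquilinear D g) (hε : IsSigned ε D g) (a x y x' y' : P) :
    coRight (coL D g x' y') (coL D f x y a)
      = ε • pair (insAB y') f g (-del3 D) (delC D) a x x' y := by
  rw [coRight_coL (coL_equivariant hg x' y'),
    ← pair_swap hε (fun z => insB_comp D z y') commute_delB_add_delC_delB (by abel), pair]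
  congr 2
  exact LinearMap.ext fun z => tmul_subst z _

theorem coRight_coR_coL (hg : IsSesquilinear D g) (hε : IsSigned ε D g) (a x y x' y' : P) :
    coRight (coR D g x' y') (coL D f x y a)
      = ε • pair (insAC x') f g (-del3 D) (delB D) a x y' y := by
  rw [coRight_coL (coR_equivariant hg x' y'),
    ← pair_swap hε (fun z => insC_comp D z x') commute_delB_add_delC_delC (by abel), pair]
  congr 2
  exact LinearMap.ext fun z => tmul_subst z _

theorem coRight_coL_coR (hg : IsSesquilinear D g) (hε : IsSigned ε D g) (a x y x' y' : P) :
    coRight (coL D g x' y') (coR D f x y a)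
      = ε • nest (insB x y') g f (delC D) (-del3 D) x' a y := by
  rw [coRight_coR (coL_equivariant hg x' y'),
    ← subst_flip_eq_nest hε (insB_comp D x y') commute_delB_add_delC_delB (by abel)]
  congr 2
  exact LinearMap.ext fun z => tmul_subst x _

theorem coRight_coR_coR (hg : IsSesquilinear D g) (hε : IsSigned ε D g) (a x y x' y' : P) :
    coRight (coR D g x' y') (coR D f x y a)
      = ε • nest (insC x x') g f (delB D) (-del3 D) y' a y := by
  rw [coRight_coR (coR_equivariant hg x' y'),
    ← subst_flip_eq_nest hε (insC_comp D x x') commute_delB_add_delC_delC (by abel)]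
  congr 2
  exact LinearMap.ext fun z => tmul_subst x _

theorem coLeft_coL_coL (hg : IsSesquilinear D g) (hε : IsSigned ε D g) (a x y x' y' : P) :
    coLeft (coL D g x' y') (coL D f x y a)
      = ε • nest (insA y' y) g f (delB D) (-del3 D) x' a x := by
  rw [coLeft_coL (coL_equivariant hg x' y'),
    ← subst_flip_eq_nest hε (insA_comp D y' y) commute_delA_add_delB_delA (by abel)]
  congr 2
  exact LinearMap.ext fun z => tensorRight_subst y _

theorem coLeft_coR_coL (hg : IsSesquilinear D g) (hε : IsSigned ε D g) (a x y x' y' : P) :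
    coLeft (coR D g x' y') (coL D f x y a)
      = ε • nest (insB x' y) g f (delA D) (-del3 D) y' a x := by
  rw [coLeft_coL (coR_equivariant hg x' y'),
    ← subst_flip_eq_nest hε (insB_comp D x' y) commute_delA_add_delB_delB (by abel)]
  congr 2
  exact LinearMap.ext fun z => tensorRight_subst y _

theorem coLeft_coL_coR (hg : IsSesquilinear D g) (hε : IsSigned ε D g) (a x y x' y' : P) :
    coLeft (coL D g x' y') (coR D f x y a)
      = ε • pair (insAC y').flip f g (-del3 D) (delB D) a y x' x := by
  rw [coLeft_coR (coL_equivariant hg x' y'),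
    ← pair_swap hε (fun z => insA_comp D y' z) commute_delA_add_delB_delA (by abel), pair]
  congr 2
  exact LinearMap.ext fun z => tensorRight_subst z _

theorem coLeft_coR_coR (hg : IsSesquilinear D g) (hε : IsSigned ε D g) (a x y x' y' : P) :
    coLeft (coR D g x' y') (coR D f x y a)
      = ε • pair (insBC x').flip f g (-del3 D) (delA D) a y y' x := by
  rw [coLeft_coR (coR_equivariant hg x' y'),
    ← pair_swap hε (fun z => insB_comp D x' z) commute_delA_add_delB_delB (by abel), pair]
  congr 2
  exact LinearMap.ext fun z => tensorRight_subst z _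

theorem tau12_comp_delA : tau12 k P ∘ₗ delA D = delB D ∘ₗ tau12 k P :=
  ext₃ fun u v w => by simp [tau12, delA, delB]

theorem tau12_comp_delB : tau12 k P ∘ₗ delB D = delA D ∘ₗ tau12 k P :=
  ext₃ fun u v w => by simp [tau12, delA, delB]

theorem tau12_comp_delC : tau12 k P ∘ₗ delC D = delC D ∘ₗ tau12 k P :=
  ext₃ fun u v w => by simp [tau12, delC]

theorem tau12_comp_del3 : tau12 k P ∘ₗ (-del3 D) = (-del3 D) ∘ₗ tau12 k P := by
  rw [LinearMap.comp_neg, LinearMap.neg_comp, del3, LinearMap.comp_add, LinearMap.comp_add,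
    tau12_comp_delA, tau12_comp_delB, tau12_comp_delC, LinearMap.add_comp, LinearMap.add_comp]
  abel

theorem tau12_coRight_coL_coL (hg : IsSesquilinear D g) (hε : IsSigned ε D g) (a x y x' y' : P) :
    tau12 k P (coRight (coL D g x' y') (coL D f x y a))
      = ε • pair (insAB y').flip f g (-del3 D) (delC D) a x x' y := by
  rw [coRight_coL_coL hg hε, map_smul, map_pair tau12_comp_del3 tau12_comp_delC]
  rfl

theorem tau12_coRight_coR_coL (hg : IsSesquilinear D g) (hε : IsSigned ε D g) (a x y x' y' : P) :
    tau12 k P (coRight (coR D g x' y') (coL D f x y a))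
      = ε • pair (insBC x') f g (-del3 D) (delA D) a x y' y := by
  rw [coRight_coR_coL hg hε, map_smul, map_pair tau12_comp_del3 tau12_comp_delB]
  rfl

theorem tau12_coRight_coL_coR (hg : IsSesquilinear D g) (hε : IsSigned ε D g) (a x y x' y' : P) :
    tau12 k P (coRight (coL D g x' y') (coR D f x y a))
      = ε • nest (insA x y') g f (delC D) (-del3 D) x' a y := by
  rw [coRight_coL_coR hg hε, map_smul, map_nest tau12_comp_delC tau12_comp_del3]
  rfl

theorem tau12_coRight_coR_coR (hg : IsSesquilinear D g) (hε : IsSigned ε D g) (a x y x' y' : P) :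
    tau12 k P (coRight (coR D g x' y') (coR D f x y a))
      = ε • nest (insC x' x) g f (delA D) (-del3 D) y' a y := by
  rw [coRight_coR_coR hg hε, map_smul, map_nest tau12_comp_delB tau12_comp_del3]
  rfl

end Iterated

/-! ### The correction terms built from r + τr -/

section Correction

variable {k : Type*} [Field k] {P : Type*} [AddCommGroup P] [Module k P]
variable {D : Module.End k P} {f g : P →ₗ[k] P →ₗ[k] Pol P}

theorem tensorRight_coL (a u v y : P) :
    tensorRight (coL D f u v a) y
      = actA (-(delA D + delB D)) (f a) (tensorRight (u ⊗ₜ[k] v) y) := by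
  rw [tensorRight, tensorRight, TensorProduct.assoc_tmul, actA_tmul]
  exact tensorRight_subst y _

theorem tensorRight_coR (a u v y : P) :
    tensorRight (coR D f u v a) y
      = actB (-(delA D + delB D)) (f a) (tensorRight (u ⊗ₜ[k] v) y) := by
  rw [tensorRight, tensorRight, TensorProduct.assoc_tmul, actB_tmul]
  exact tensorRight_subst y _

/-- The action with variable I⊗I⊗∂ adds the third derivation to the first slot, so the variable
-∂^{⊗2} ⊗ I used in the correction turns into -∂^{⊗3}. -/
theorem actA_comp_delA_add_delB (hg : IsSesquilinear D g) (x : P) :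
    actA (delC D) (g x) ∘ₗ (-(delA D + delB D)) = (-del3 D) ∘ₗ actA (delC D) (g x) := by
  rw [LinearMap.comp_neg, LinearMap.comp_add, actA_comp_delA hg x (commute_delA_delC D).symm,
    actA_comp_delB (g x) (commute_delB_delC D).symm, ← LinearMap.add_comp, ← LinearMap.neg_comp,
    del3]
  congr 1
  abel

theorem actA_tensorRight_coL (hg : IsSesquilinear D g) (a u v x y : P) :
    actA (delC D) (g x) (tensorRight (coL D f u v a) y)
      = nest (insA v y) g f (delC D) (-del3 D) x a u := by
  rw [tensorRight_coL, tensorRight, TensorProduct.assoc_tmul, actA_tmul,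
    map_subst (actA_comp_delA_add_delB hg x), actA_comp_insA]
  rfl

theorem actA_tensorRight_coR (hg : IsSesquilinear D g) (a u v x y : P) :
    actA (delC D) (g x) (tensorRight (coR D f u v a) y)
      = pair (insAB y).flip f g (-del3 D) (delC D) a v x u := by
  rw [tensorRight_coR, tensorRight, TensorProduct.assoc_tmul, actB_tmul,
    map_subst (actA_comp_delA_add_delB hg x), actA_comp_insB]
  rfl

end Correction

/-! ### Consequences of associativity and the Leibniz rule -/

section NestIdentities

variable {k : Type*} [Field k] {P : Type*} [AddCommGroup P] [Module k P]
variable {W : Type*} [AddCommGroup W] [Module k W]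
variable {D : Module.End k P} {br m : P →ₗ[k] P →ₗ[k] Pol P}
variable {φ : P →ₗ[k] W} {S T R E : Module.End k W}

/-- `a (b c) = b (a c)`. -/
theorem nest_left_comm (hP : IsPoissonConformalAlgebra D br m) (hφ : φ ∘ₗ D = E ∘ₗ φ)
    (hSE : Commute S E) (hTE : Commute T E) (hST : Commute S T) (h : S + T + R + E = 0)
    (a b c : P) :
    nest φ m m S T a b c = nest φ m m T S b a c := by
  -- The conservation law determines `R`, which therefore inherits its commutation relations from
  -- those of `S`, `T` and `E`.
  have hR : R = -S - T - E := by
    rw [show R = S + T + R + E - S - T - E by abel, h]; abel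
  have hRE : Commute R E := by
    rw [hR]; exact (hSE.neg_left.sub_left hTE).sub_left (Commute.refl E)
  have hRT : Commute R T := by
    rw [hR]; exact (hST.neg_left.sub_left (Commute.refl T)).sub_left hTE.symm
  rw [nest_assoc hP hφ hSE hTE hST h,
    nest_assoc hP hφ hTE hSE hST.symm (show T + S + R + E = 0 by rw [← h]; abel),
    nest_swap (R := S) hP.assoc.sesquilinear hP.comm.isSigned hφ hRE hTE hRT
      (by rw [← h]; abel), one_smul]

/-- `[a, b c] = -b [c, a] - c [b, a]`. -/
theorem nest_leibniz_swap (hP : IsPoissonConformalAlgebra D br m) (hφ : φ ∘ₗ D = E ∘ₗ φ)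
    (hSE : Commute S E) (hTE : Commute T E) (hST : Commute S T) (h : S + T + R + E = 0)
    (a b c : P) :
    nest φ br m S T a b c = -nest φ m br T R b c a - nest φ m br R T c b a := by
  have hR : R = -S - T - E := by
    rw [show R = S + T + R + E - S - T - E by abel, h]; abel
  have hRE : Commute R E := by
    rw [hR]; exact (hSE.neg_left.sub_left hTE).sub_left (Commute.refl E)
  have hRS : Commute R S := by
    rw [hR]; exact ((Commute.refl S).neg_left.sub_left hST.symm).sub_left hSE.symm
  rw [nest_leibniz hP hφ hSE hTE hST h,
    nest_swap (R := R) hP.assoc.sesquilinear hP.lie.isSigned hφ hTE hSE hST.symm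
      (by rw [← h]; abel),
    nest_swap (R := T) hP.assoc.sesquilinear hP.lie.isSigned hφ hRE hSE hRS
      (by rw [← h]; abel)]
  module

/-- `[a, b c] + [b, a c] + [c, a b] = 0`. -/
theorem nest_leibniz_cycle (hP : IsPoissonConformalAlgebra D br m) (hφ : φ ∘ₗ D = E ∘ₗ φ)
    (hSE : Commute S E) (hTE : Commute T E) (hST : Commute S T) (h : S + T + R + E = 0)
    (a b c : P) :
    nest φ br m S T a b c + nest φ br m T S b a c + nest φ br m R S c a b = 0 := by
  have hR : R = -S - T - E := by
    rw [show R = S + T + R + E - S - T - E by abel, h]; abel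
  have hRE : Commute R E := by
    rw [hR]; exact (hSE.neg_left.sub_left hTE).sub_left (Commute.refl E)
  have hRS : Commute R S := by
    rw [hR]; exact ((Commute.refl S).neg_left.sub_left hST.symm).sub_left hSE.symm
  rw [nest_leibniz hP hφ hSE hTE hST h,
    nest_leibniz_swap hP hφ hTE hSE hST.symm (show T + S + R + E = 0 by rw [← h]; abel),
    nest_leibniz hP hφ hRE hSE hRS (show R + S + T + E = 0 by rw [← h]; abel),
    nest_swap (R := T) hP.assoc.sesquilinear hP.lie.isSigned hφ hSE hRE hRS.symm
      (by rw [← h]; abel),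
    nest_swap (S := T) (T := R) (R := S) hP.assoc.sesquilinear hP.lie.isSigned hφ hTE hRE
      (by rw [hR]; exact (hST.symm.neg_right.sub_right (Commute.refl T)).sub_right hTE)
      (by rw [← h]; abel)]
  module

end NestIdentities

/-! ### Double sums over two copies of r -/

section Sums

variable {k : Type*} [Field k] {P : Type*} [AddCommGroup P] [Module k P]
variable {ι : Type*} [Fintype ι]

/-- The two copies of r are interchangeable, so it suffices to match summands up to a renaming of
the indices. -/
theorem sum_sum_eq_of_swap {W : Type*} [AddCommGroup W] {F G : ι → ι → W} (H : ι → ι → W)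
    (h : ∀ i j, F i j = G i j + H i j - H j i) : ∑ i, ∑ j, F i j = ∑ i, ∑ j, G i j := by
  simp only [h, Finset.sum_add_distrib, Finset.sum_sub_distrib]
  rw [Finset.sum_comm (f := fun i j => H j i)]
  abel

theorem coRight_add (f g : P →ₗ[k] P ⊗[k] P) : coRight (f + g) = coRight f + coRight g :=
  LinearMap.lTensor_add P f g

theorem coRight_sub (f g : P →ₗ[k] P ⊗[k] P) : coRight (f - g) = coRight f - coRight g :=
  LinearMap.lTensor_sub f g

theorem coLeft_add (f g : P →ₗ[k] P ⊗[k] P) : coLeft (f + g) = coLeft f + coLeft g := by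
  rw [coLeft, LinearMap.rTensor_add, LinearMap.comp_add]; rfl

theorem coLeft_sub (f g : P →ₗ[k] P ⊗[k] P) : coLeft (f - g) = coLeft f - coLeft g := by
  rw [coLeft, LinearMap.rTensor_sub, LinearMap.comp_sub]; rfl

theorem coRight_sum_apply (F G : ι → P →ₗ[k] P ⊗[k] P) (a : P) :
    coRight (∑ j, F j) ((∑ i, G i) a) = ∑ i, ∑ j, coRight (F j) (G i a) := by
  have : coRight (∑ j, F j) = ∑ j, coRight (F j) :=
    map_sum (LinearMap.lTensorHom P) F Finset.univ
  rw [LinearMap.sum_apply, map_sum]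
  simp only [this, LinearMap.sum_apply]

theorem coLeft_sum_apply (F G : ι → P →ₗ[k] P ⊗[k] P) (a : P) :
    coLeft (∑ j, F j) ((∑ i, G i) a) = ∑ i, ∑ j, coLeft (F j) (G i a) := by
  have : (∑ j, F j).rTensor P = ∑ j, (F j).rTensor P :=
    map_sum (LinearMap.rTensorHom P) F Finset.univ
  simp only [coLeft, this, LinearMap.comp_apply, LinearMap.sum_apply, map_sum]

theorem tensorRight_add (s t : P ⊗[k] P) (z : P) :
    tensorRight (s + t) z = tensorRight s z + tensorRight t z := by
  rw [tensorRight, TensorProduct.add_tmul, map_add]; rfl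

theorem tensorRight_sum (t : ι → P ⊗[k] P) (z : P) :
    tensorRight (∑ i, t i) z = ∑ i, tensorRight (t i) z := by
  rw [tensorRight, TensorProduct.sum_tmul, map_sum]; rfl

theorem tensorRight_zero (z : P) : tensorRight (0 : P ⊗[k] P) z = 0 := by
  rw [tensorRight, TensorProduct.zero_tmul, map_zero]

theorem add_tau_sum (x y : ι → P) :
    (∑ i, x i ⊗ₜ[k] y i) + tau k P (∑ i, x i ⊗ₜ[k] y i)
      = ∑ i, (x i ⊗ₜ[k] y i + y i ⊗ₜ[k] x i) := by
  rw [map_sum, ← Finset.sum_add_distrib]; rfl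

end Sums

/-! ### The defects of the coalgebra axioms -/

section Defects

variable {k : Type*} [Field k] {P : Type*} [AddCommGroup P] [Module k P]
variable {D : Module.End k P} {br m : P →ₗ[k] P →ₗ[k] Pol P}
variable {ι : Type*} [Fintype ι]

/-- The coassociativity defect of the coboundary map is the action on `r • r`. -/
theorem coassoc_defect (hP : IsPoissonConformalAlgebra D br m) (x y : ι → P) (a : P) :
    coRight (coboundaryAssoc D m (∑ i, x i ⊗ₜ[k] y i))
        (coboundaryAssoc D m (∑ i, x i ⊗ₜ[k] y i) a)
      - coLeft (coboundaryAssoc D m (∑ i, x i ⊗ₜ[k] y i))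
        (coboundaryAssoc D m (∑ i, x i ⊗ₜ[k] y i) a)
      = actC (-del3 D) (m a) (aybe D m x y) - actA (-del3 D) (m a) (aybe D m x y) := by
  have hm := hP.assoc.sesquilinear
  have hε := hP.comm.isSigned
  rw [coboundaryAssoc_eq_sum, coRight_sum_apply, coLeft_sum_apply, aybe_eq_sum]
  simp only [map_sum, ← Finset.sum_sub_distrib]
  -- In an iterated coboundary `a` always acts on a leg of copy `i`, whereas after the Yang–Baxter
  -- actions are expanded it may act on copy `j`. The function supplied collects the terms that
  -- match only after the copies are exchanged.
  refine sum_sum_eq_of_swap (fun i j =>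
    nest (insB (x j) (y i)) m m (delA D) (-del3 D) (y j) a (x i)
    - nest (insA (y j) (y i)) m m (delB D) (-del3 D) (x j) a (x i)
    - pair (insBC (x j)).flip m m (-del3 D) (delA D) a (y i) (y j) (x i)
    + pair (insAC (y j)).flip m m (-del3 D) (delB D) a (y i) (x j) (x i)) fun i j => ?_
  simp only [coRight_sub, coLeft_sub, LinearMap.sub_apply, map_sub,
    coRight_coL_coL hm hε, coRight_coL_coR hm hε, coRight_coR_coL hm hε, coRight_coR_coR hm hε,
    coLeft_coL_coL hm hε, coLeft_coL_coR hm hε, coLeft_coR_coL hm hε, coLeft_coR_coR hm hε,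
    actA_yb hm hε, actC_yb hm hε, one_smul]
  -- Neither action on r • r produces a nested product in the middle slot. The ones from I ⊗ Δ and Δ
  -- ⊗ I cancel against each other, since xⱼ(a yᵢ) = yᵢ(a xⱼ), once the copies are exchanged.
  rw [nest_assoc (R := delB D) hP (insC_comp D (x i) (x j)) (commute_del3_delC D)
      (commute_delA_delC D) (commute_del3_delA D) (by rw [del3]; abel) a (y i) (y j),
    nest_left_comm (R := delC D) hP (insA_comp D (y i) (y j)) (commute_del3_delA D)
      (commute_delA_delB D).symm (commute_del3_delB D) (by rw [del3]; abel) a (x i) (x j),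
    ← nest_left_comm (R := delA D) hP (insB_comp D (x i) (y j)) (commute_del3_delB D)
      (commute_delB_delC D).symm (commute_del3_delC D) (by rw [del3]; abel) a (x j) (y i),
    nest_assoc (R := delA D) hP (insB_comp D (x i) (y j)) (commute_del3_delB D)
      (commute_delB_delC D).symm (commute_del3_delC D) (by rw [del3]; abel) a (x j) (y i)]
  abel

set_option maxHeartbeats 1000000 in
/-- The co-Jacobi defect of the coboundary map is the action on `[[r, r]]`, up to a correction
that depends on `r + τ r` only. -/
theorem cojacobi_defect (hL : IsLieConformalAlgebra D br) (x y : ι → P) (a : P) :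
    coRight (coboundaryLie D br (∑ i, x i ⊗ₜ[k] y i))
        (coboundaryLie D br (∑ i, x i ⊗ₜ[k] y i) a)
      - tau12 k P (coRight (coboundaryLie D br (∑ i, x i ⊗ₜ[k] y i))
        (coboundaryLie D br (∑ i, x i ⊗ₜ[k] y i) a))
      - coLeft (coboundaryLie D br (∑ i, x i ⊗ₜ[k] y i))
        (coboundaryLie D br (∑ i, x i ⊗ₜ[k] y i) a)
      = (actA (-del3 D) (br a) (cybe D br x y) + actB (-del3 D) (br a) (cybe D br x y)
          + actC (-del3 D) (br a) (cybe D br x y))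
        + ∑ j, actA (delC D) (br (x j)) (tensorRight (evalAt (-del2 D)
          ((onLeft P (br a) + onRight P (br a))
            ((∑ i, x i ⊗ₜ[k] y i) + tau k P (∑ i, x i ⊗ₜ[k] y i)))) (y j)) := by
  have hs := hL.sesquilinear
  have hε := hL.isSigned
  rw [coboundaryLie_eq_sum, coRight_sum_apply, coLeft_sum_apply, cybe_eq_sum hL, add_tau_sum]
  simp only [map_sum, tensorRight_sum]
  rw [Finset.sum_comm (f := fun j i => actA (delC D) (br (x j)) _)]
  simp only [← Finset.sum_sub_distrib, ← Finset.sum_add_distrib]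
  -- The correction has two halves. Its τr half is produced by τ ⊗ I, through terms such as [xⱼ, [a,
  -- yᵢ]] ⊗ xᵢ ⊗ yⱼ. Its r half cancels terms of the action on [[r, r]] that have no counterpart on
  -- the left, such as [xⱼ, [a, xᵢ]] ⊗ yᵢ ⊗ yⱼ from the Jacobi identity. The supplied function again
  -- renames the copies.
  refine sum_sum_eq_of_swap (fun i j =>
    nest (insB (x j) (y i)) br br (delA D) (-del3 D) (y j) a (x i)
    + nest (insC (x j) (x i)) br br (delA D) (-del3 D) (y j) a (y i)
    + nest (insA (y j) (y i)) br br (delB D) (-del3 D) (x j) a (x i)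
    + pair (insBC (x j)) br br (-del3 D) (delA D) a (x i) (y j) (y i)
    + pair (insAC (y j)).flip br br (-del3 D) (delB D) a (y i) (x j) (x i)
    + pair (insBC (x j)).flip br br (-del3 D) (delA D) a (y i) (y j) (x i)) fun i j => ?_
  simp only [coRight_add, coLeft_add, LinearMap.add_apply, map_add, tensorRight_add,
    evalAt_onLeft_tmul, evalAt_onRight_tmul, actA_tensorRight_coL hs, actA_tensorRight_coR hs,
    tau12_coRight_coL_coL hs hε, tau12_coRight_coL_coR hs hε, tau12_coRight_coR_coL hs hε,
    tau12_coRight_coR_coR hs hε]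
  simp only [
    coRight_coL_coL hs hε, coRight_coL_coR hs hε, coRight_coR_coL hs hε, coRight_coR_coR hs hε,
    coLeft_coL_coL hs hε, coLeft_coL_coR hs hε, coLeft_coR_coL hs hε, coLeft_coR_coR hs hε,
    actA_yb hs hε, actB_yb hs hε, actC_yb hs hε, neg_one_smul]
  rw [nest_jacobi (R := delC D) hL (insA_comp D (y i) (y j)) (commute_del3_delA D)
      (commute_delA_delB D).symm (commute_del3_delB D) (by rw [del3]; abel) a (x i) (x j),
    nest_jacobi (R := delA D) hL (insB_comp D (x i) (y j)) (commute_del3_delB D)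
      (commute_delB_delC D).symm (commute_del3_delC D) (by rw [del3]; abel) a (x j) (y i),
    nest_jacobi (R := delB D) hL (insC_comp D (x i) (x j)) (commute_del3_delC D)
      (commute_delA_delC D) (commute_del3_delA D) (by rw [del3]; abel) a (y i) (y j)]
  abel

set_option maxHeartbeats 1000000 in
/-- The defect of the Leibniz rule for the coboundary maps. -/
theorem coleibniz_defect (hP : IsPoissonConformalAlgebra D br m) (x y : ι → P) (a : P) :
    coRight (coboundaryAssoc D m (∑ i, x i ⊗ₜ[k] y i))
        (coboundaryLie D br (∑ i, x i ⊗ₜ[k] y i) a)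
      - coLeft (coboundaryLie D br (∑ i, x i ⊗ₜ[k] y i))
        (coboundaryAssoc D m (∑ i, x i ⊗ₜ[k] y i) a)
      - tau12 k P (coRight (coboundaryLie D br (∑ i, x i ⊗ₜ[k] y i))
        (coboundaryAssoc D m (∑ i, x i ⊗ₜ[k] y i) a))
      = actA (-del3 D) (br a) (aybe D m x y)
        - (actB (-del3 D) (m a) (cybe D br x y) - actC (-del3 D) (m a) (cybe D br x y))
        + ∑ j, actA (delC D) (br (x j))
          (evalAt (-(delA D + delB D)) ((onA (m a) - onB (m a))
            (tensorRight ((∑ i, x i ⊗ₜ[k] y i) + tau k P (∑ i, x i ⊗ₜ[k] y i)) (y j)))) := by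
  have hb := hP.lie.sesquilinear
  have hm := hP.assoc.sesquilinear
  have hbε := hP.lie.isSigned
  have hmε := hP.comm.isSigned
  have hcorr : ∀ t : P ⊗[k] (P ⊗[k] P),
      evalAt (-(delA D + delB D)) ((onA (m a) - onB (m a)) t)
        = actA (-(delA D + delB D)) (m a) t - actB (-(delA D + delB D)) (m a) t := fun t => by
    rw [LinearMap.sub_apply, map_sub]; rfl
  rw [coboundaryLie_eq_sum, coboundaryAssoc_eq_sum, coRight_sum_apply, coRight_sum_apply,
    coLeft_sum_apply, cybe_eq_sum hP.lie, aybe_eq_sum, add_tau_sum]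
  simp only [map_sum, tensorRight_sum]
  rw [Finset.sum_comm (f := fun j i => actA (delC D) (br (x j)) _)]
  simp only [← Finset.sum_sub_distrib, ← Finset.sum_add_distrib]
  refine sum_sum_eq_of_swap (fun i j =>
    nest (insC (x j) (x i)) br m (delA D) (-del3 D) (y j) a (y i)
    - nest (insB (x j) (y i)) br m (delA D) (-del3 D) (y j) a (x i)
    - nest (insA (y j) (y i)) br m (delB D) (-del3 D) (x j) a (x i)
    - pair (insBC (x j)) m br (-del3 D) (delA D) a (x i) (y j) (y i)
    + pair (insAC (y j)).flip m br (-del3 D) (delB D) a (y i) (x j) (x i)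
    + pair (insBC (x j)).flip m br (-del3 D) (delA D) a (y i) (y j) (x i)) fun i j => ?_
  simp only [hcorr]
  simp only [coRight_add, coRight_sub, coLeft_add, LinearMap.add_apply, LinearMap.sub_apply,
    map_add, map_sub, tensorRight_add, ← tensorRight_coL, ← tensorRight_coR,
    actA_tensorRight_coL hb, actA_tensorRight_coR hb,
    coRight_coL_coL hm hmε, coRight_coL_coR hm hmε, coRight_coR_coL hm hmε,
    coRight_coR_coR hm hmε, tau12_coRight_coL_coL hb hbε, tau12_coRight_coL_coR hb hbε,
    tau12_coRight_coR_coL hb hbε, tau12_coRight_coR_coR hb hbε,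
    coLeft_coL_coL hb hbε, coLeft_coL_coR hb hbε, coLeft_coR_coL hb hbε, coLeft_coR_coR hb hbε,
    actA_yb hb hmε, actB_yb hm hbε, actC_yb hm hbε, neg_one_smul, one_smul]
  -- In the first slot the action on r • r gives [a, xᵢ xⱼ], while δ ⊗ I and the correction give
  -- brackets of the form [x, a x']. The cyclic identity relates them without expanding any of them.
  have hA := nest_leibniz_cycle (R := delC D) hP (insA_comp D (y i) (y j)) (commute_del3_delA D)
    (commute_delA_delB D).symm (commute_del3_delB D) (by rw [del3]; abel) a (x i) (x j)
  rw [add_assoc] at hA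
  rw [eq_neg_of_add_eq_zero_left hA,
    nest_leibniz_swap (R := delC D) hP (insB_comp D (x i) (y j)) (commute_delA_delB D)
      (commute_del3_delB D) (commute_del3_delA D).symm (by rw [del3]; abel) (y i) a (x j),
    nest_leibniz_swap (R := delB D) hP (insC_comp D (x i) (x j)) (commute_delA_delC D)
      (commute_del3_delC D) (commute_del3_delA D).symm (by rw [del3]; abel) (y i) a (y j),
    nest_swap (S := -del3 D) (T := delA D) (R := delB D) hm hbε (insC_comp D (x i) (x j))
      (commute_del3_delC D) (commute_delA_delC D) (commute_del3_delA D) (by rw [del3]; abel)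
      a (y i) (y j), neg_one_smul]
  abel

end Defects

/-! ### Conditions 4 to 8: the same calculus with values in (P ⊗ P)[λ] -/

section Compatibility

variable {k : Type*} [Field k] {P : Type*} [AddCommGroup P] [Module k P]

/-- A polynomial is its own value at λ. Thus (P ⊗ P)[λ] can serve as the target of the calculus,
with multiplication by λ and by -λ-∂^{⊗2} as the variables of `a` and `b`. -/
theorem coeffwise_eq_subst {V W : Type*} [AddCommGroup V] [Module k V] [AddCommGroup W]
    [Module k W] (φ : V →ₗ[k] W) (p : Pol V) :
    coeffwise φ p = subst (lam k W) (const k W ∘ₗ φ) p := by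
  have hlam : ∀ (n : ℕ) (w : W),
      (lam k W ^ n) (const k W w) = Finsupp.single n w := by
    intro n w
    induction n with
    | zero => simp [const]
    | succ n ih => rw [pow_succ', Module.End.mul_apply, ih]; simp [lam]
  have : coeffwise φ = subst (lam k W) (const k W ∘ₗ φ) := by
    refine Finsupp.lhom_ext fun n v => ?_
    rw [coeffwise_single, subst_single, LinearMap.comp_apply, hlam]
  rw [this]

/-- Coefficientwise `∂ ⊗ I` on `(P ⊗ P)[λ]`. -/
def polL (D : Module.End k P) : Module.End k (Pol (P ⊗[k] P)) := coeffwise (D.rTensor P)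

/-- Coefficientwise `I ⊗ ∂` on `(P ⊗ P)[λ]`. -/
def polR (D : Module.End k P) : Module.End k (Pol (P ⊗[k] P)) := coeffwise (D.lTensor P)

/-- Multiplication by `-λ - ∂^{⊗2}` on `(P ⊗ P)[λ]`. -/
def polNeg (D : Module.End k P) : Module.End k (Pol (P ⊗[k] P)) :=
  -(lam k (P ⊗[k] P) + polL D + polR D)

/-- `z ↦ z ⊗ y` in `(P ⊗ P)[λ]`. -/
def polInL (y : P) : P →ₗ[k] Pol (P ⊗[k] P) :=
  const k (P ⊗[k] P) ∘ₗ (TensorProduct.mk k P P).flip y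

/-- `z ↦ x ⊗ z` in `(P ⊗ P)[λ]`. -/
def polInR (x : P) : P →ₗ[k] Pol (P ⊗[k] P) :=
  const k (P ⊗[k] P) ∘ₗ TensorProduct.mk k P P x

/-- `z ↦ w ↦ z ⊗ w` in `(P ⊗ P)[λ]`. -/
def polIn (k P : Type*) [Field k] [AddCommGroup P] [Module k P] :
    P →ₗ[k] P →ₗ[k] Pol (P ⊗[k] P) :=
  (TensorProduct.mk k P P).compr₂ (const k (P ⊗[k] P))

section Operators

variable {V W : Type*} [AddCommGroup V] [Module k V] [AddCommGroup W] [Module k W]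

theorem coeffwise_comp_lam (h : V →ₗ[k] W) :
    coeffwise h ∘ₗ lam k V = lam k W ∘ₗ coeffwise h := by
  refine Finsupp.lhom_ext fun n v => ?_
  simp [coeffwise_single, lam]

theorem coeffwise_comp_const (h : V →ₗ[k] W) :
    coeffwise h ∘ₗ const k V = const k W ∘ₗ h := by
  ext1 v; simp [const, coeffwise_single]

theorem coeffwise_comp {U : Type*} [AddCommGroup U] [Module k U] (h : V →ₗ[k] W)
    (h' : U →ₗ[k] V) : coeffwise h ∘ₗ coeffwise h' = coeffwise (h ∘ₗ h') := by
  refine Finsupp.lhom_ext fun n v => ?_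
  simp [coeffwise_single]

theorem coeffwise_coeffwise {U : Type*} [AddCommGroup U] [Module k U] (h : V →ₗ[k] W)
    (h' : U →ₗ[k] V) (p : Pol U) : coeffwise h (coeffwise h' p) = coeffwise (h ∘ₗ h') p :=
  LinearMap.congr_fun (coeffwise_comp h h') p

theorem coeffwise_add (h h' : V →ₗ[k] W) : coeffwise (h + h') = coeffwise h + coeffwise h' := by
  refine Finsupp.lhom_ext fun n v => ?_
  simp [coeffwise_single]

end Operators

variable {D : Module.End k P} {f g br m : P →ₗ[k] P →ₗ[k] Pol P}

theorem polNeg_eq : polNeg D = -lam k (P ⊗[k] P) - coeffwise (del2 D) := by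
  rw [polNeg, del2, coeffwise_add]
  simp only [polL, polR]
  abel

/-- The conservation law for conditions 4 to 8: the variables of `a` and `b` and the derivations of
the two slots add up to zero. -/
theorem polNeg_add : lam k (P ⊗[k] P) + polNeg D + polR D + polL D = 0 := by
  rw [polNeg]; abel

theorem commute_lam_polL : Commute (lam k (P ⊗[k] P)) (polL D) :=
  (coeffwise_comp_lam _).symm

theorem commute_lam_polR : Commute (lam k (P ⊗[k] P)) (polR D) :=
  (coeffwise_comp_lam _).symm

theorem commute_polL_polR : Commute (polL D) (polR D) := by
  change coeffwise _ ∘ₗ coeffwise _ = coeffwise _ ∘ₗ coeffwise _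
  rw [coeffwise_comp, coeffwise_comp]
  congr 1
  ext u v
  simp

theorem commute_polNeg_polL : Commute (polNeg D) (polL D) :=
  (((commute_lam_polL (D := D)).add_left (Commute.refl _)).add_left
    commute_polL_polR.symm).neg_left

theorem commute_polNeg_polR : Commute (polNeg D) (polR D) :=
  (((commute_lam_polR (D := D)).add_left commute_polL_polR).add_left (Commute.refl _)).neg_left

theorem commute_lam_polNeg : Commute (lam k (P ⊗[k] P)) (polNeg D) :=
  (((Commute.refl (lam k (P ⊗[k] P))).add_right commute_lam_polL).add_right
    commute_lam_polR).neg_right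

theorem polInL_comp (y : P) : polInL y ∘ₗ D = polL D ∘ₗ polInL y := by
  rw [polInL, polL, ← LinearMap.comp_assoc, coeffwise_comp_const]
  rfl

theorem polInR_comp (x : P) : polInR x ∘ₗ D = polR D ∘ₗ polInR x := by
  rw [polInR, polR, ← LinearMap.comp_assoc, coeffwise_comp_const]
  rfl

theorem const_comp_del2 :
    const k (P ⊗[k] P) ∘ₗ (-del2 D) = (-(polL D + polR D)) ∘ₗ const k (P ⊗[k] P) := by
  rw [polL, polR, ← coeffwise_add, LinearMap.neg_comp, coeffwise_comp_const, del2,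
    LinearMap.comp_neg]

theorem onLeft_comp_del2 (hf : IsSesquilinear D f) (a : P) :
    onLeft P (f a) ∘ₗ (-del2 D) = polNeg D ∘ₗ onLeft P (f a) := by
  ext1
  ext1 u
  ext1 v
  have h1 := LinearMap.congr_fun (coeffwise_comp_lam ((TensorProduct.mk k P P).flip v)) (f a u)
  have h2 : coeffwise ((TensorProduct.mk k P P).flip v) (coeffwise D (f a u))
      = polL D (coeffwise ((TensorProduct.mk k P P).flip v) (f a u)) := by
    rw [polL, coeffwise_coeffwise, coeffwise_coeffwise]
    rfl
  have h3 : coeffwise ((TensorProduct.mk k P P).flip (D v)) (f a u)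
      = polR D (coeffwise ((TensorProduct.mk k P P).flip v) (f a u)) := by
    rw [polR, coeffwise_coeffwise]
    rfl
  simp only [LinearMap.comp_apply] at h1
  simp only [LinearMap.comp_apply, TensorProduct.AlgebraTensorModule.curry_apply,
    TensorProduct.curry_apply, LinearMap.coe_restrictScalars, LinearMap.neg_apply, map_neg, del2,
    LinearMap.add_apply, map_add, LinearMap.rTensor_tmul, LinearMap.lTensor_tmul, onLeft_tmul,
    hf.right, h1, h2, h3, polNeg]
  abel

theorem onRight_comp_del2 (hf : IsSesquilinear D f) (a : P) :
    onRight P (f a) ∘ₗ (-del2 D) = polNeg D ∘ₗ onRight P (f a) := by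
  ext1
  ext1 u
  ext1 v
  have h1 := LinearMap.congr_fun (coeffwise_comp_lam (TensorProduct.mk k P P u)) (f a v)
  have h2 : coeffwise (TensorProduct.mk k P P u) (coeffwise D (f a v))
      = polR D (coeffwise (TensorProduct.mk k P P u) (f a v)) := by
    rw [polR, coeffwise_coeffwise, coeffwise_coeffwise]
    rfl
  have h3 : coeffwise (TensorProduct.mk k P P (D u)) (f a v)
      = polL D (coeffwise (TensorProduct.mk k P P u) (f a v)) := by
    rw [polL, coeffwise_coeffwise]
    rfl
  simp only [LinearMap.comp_apply] at h1
  simp only [LinearMap.comp_apply, TensorProduct.AlgebraTensorModule.curry_apply,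
    TensorProduct.curry_apply, LinearMap.coe_restrictScalars, LinearMap.neg_apply, map_neg, del2,
    LinearMap.add_apply, map_add, LinearMap.rTensor_tmul, LinearMap.lTensor_tmul, onRight_tmul,
    hf.right, h1, h2, h3, polNeg]
  abel

theorem onLeft_coL (hf : IsSesquilinear D f) (a b x y : P) :
    onLeft P (f a) (coL D g x y b) = nest (polInL y) f g (lam k _) (polNeg D) a b x := by
  rw [coL, LinearMap.comp_apply, map_subst (onLeft_comp_del2 hf a), nest]
  congr 2
  refine LinearMap.ext fun z => ?_
  exact (onLeft_tmul (f a) z y).trans (coeffwise_eq_subst _ _)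

theorem onLeft_coR (hf : IsSesquilinear D f) (a b x y : P) :
    onLeft P (f a) (coR D g x y b) = pair (polIn k P) f g (lam k _) (polNeg D) a x b y := by
  rw [coR, LinearMap.comp_apply, map_subst (onLeft_comp_del2 hf a), pair_comm commute_lam_polNeg,
    pair]
  congr 2
  refine LinearMap.ext fun z => ?_
  exact (onLeft_tmul (f a) x z).trans (coeffwise_eq_subst _ _)

theorem onRight_coL (hf : IsSesquilinear D f) (a b x y : P) :
    onRight P (f a) (coL D g x y b) = pair (polIn k P) g f (polNeg D) (lam k _) b x a y := by
  rw [coL, LinearMap.comp_apply, map_subst (onRight_comp_del2 hf a), pair]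
  congr 2
  refine LinearMap.ext fun z => ?_
  exact (onRight_tmul (f a) z y).trans (coeffwise_eq_subst _ _)

theorem onRight_coR (hf : IsSesquilinear D f) (a b x y : P) :
    onRight P (f a) (coR D g x y b) = nest (polInR x) f g (lam k _) (polNeg D) a b y := by
  rw [coR, LinearMap.comp_apply, map_subst (onRight_comp_del2 hf a), nest]
  congr 2
  refine LinearMap.ext fun z => ?_
  exact (onRight_tmul (f a) x z).trans (coeffwise_eq_subst _ _)

theorem negSubst_comp_lam :
    negSubst (del2 D) ∘ₗ lam k (P ⊗[k] P) = polNeg D ∘ₗ negSubst (del2 D) := by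
  rw [negSubst, subst_comp_lam, polNeg_eq]

theorem negSubst_comp_const :
    negSubst (del2 D) ∘ₗ const k (P ⊗[k] P) = const k (P ⊗[k] P) :=
  subst_comp_const _ _

/-- The substitution λ ↦ -λ-∂^{⊗2} is an involution, so it exchanges the variables of `a` and `b`.
The terms with this substitution are then the plain ones with `a` and `b` interchanged. -/
theorem negSubst_comp_polNeg :
    negSubst (del2 D) ∘ₗ polNeg D = lam k (P ⊗[k] P) ∘ₗ negSubst (del2 D) := by
  have h : negSubst (del2 D) ∘ₗ coeffwise (del2 D)
      = coeffwise (del2 D) ∘ₗ negSubst (del2 D) := by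
    refine subst_comp_coeffwise (coeffwise_comp_const _).symm ?_
    exact (show Commute (lam k (P ⊗[k] P)) (coeffwise (del2 D)) from
      (coeffwise_comp_lam _).symm).neg_left.sub_left (Commute.refl _)
  have h' : negSubst (del2 D) ∘ₗ lam k (P ⊗[k] P)
      = (-lam k (P ⊗[k] P) - coeffwise (del2 D)) ∘ₗ negSubst (del2 D) := by
    rw [negSubst_comp_lam, polNeg_eq]
  rw [polNeg_eq, LinearMap.comp_sub, LinearMap.comp_neg, h, h', ← LinearMap.neg_comp,
    ← LinearMap.sub_comp]
  congr 1
  abel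

theorem negLeft_coL (hf : IsSesquilinear D f) (a b x y : P) :
    negLeft D (f b) (coL D g x y a) = nest (polInL y) f g (polNeg D) (lam k _) b a x := by
  rw [negLeft, onLeft_coL hf, map_nest negSubst_comp_lam negSubst_comp_polNeg, polInL,
    ← LinearMap.comp_assoc, negSubst_comp_const]

theorem negRight_coR (hf : IsSesquilinear D f) (a b x y : P) :
    negRight D (f b) (coR D g x y a) = nest (polInR x) f g (polNeg D) (lam k _) b a y := by
  rw [negRight, onRight_coR hf, map_nest negSubst_comp_lam negSubst_comp_polNeg, polInR,
    ← LinearMap.comp_assoc, negSubst_comp_const]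

theorem compr₂_polIn : (polIn k P).compr₂ (negSubst (del2 D)) = polIn k P := by
  ext1 u
  ext1 v
  exact LinearMap.congr_fun negSubst_comp_const _

theorem negLeft_coR (hf : IsSesquilinear D f) (a b x y : P) :
    negLeft D (f b) (coR D g x y a) = pair (polIn k P) f g (polNeg D) (lam k _) b x a y := by
  rw [negLeft, onLeft_coR hf, map_pair negSubst_comp_lam negSubst_comp_polNeg, compr₂_polIn]

theorem negRight_coL (hf : IsSesquilinear D f) (a b x y : P) :
    negRight D (f b) (coL D g x y a) = pair (polIn k P) g f (lam k _) (polNeg D) a x b y := by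
  rw [negRight, onRight_coL hf, map_pair negSubst_comp_polNeg negSubst_comp_lam, compr₂_polIn]

variable {ε : k}

/-- The product of `a` and `b` carries minus the total derivation of both slots. After the exchange
`x` carries the derivation of the slot of `y`, as in the triple tensors. -/
theorem coeffwise_coL (hg : IsSigned ε D g) (a b x y : P) :
    coeffwise (coL D g x y) (f a b)
      = ε • nest (polInL y) g f (polR D) (lam k _) x a b := by
  rw [coeffwise_eq_subst, ← subst_flip_eq_nest (Z := -(polL D + polR D)) hg (polInL_comp y)
    ((Commute.refl (polL D)).add_left commute_polL_polR.symm).neg_left (by abel)]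
  congr 2
  exact LinearMap.ext fun z => map_subst const_comp_del2 _ _

theorem coeffwise_coR (hg : IsSigned ε D g) (a b x y : P) :
    coeffwise (coR D g x y) (f a b)
      = ε • nest (polInR x) g f (polL D) (lam k _) y a b := by
  rw [coeffwise_eq_subst, ← subst_flip_eq_nest (Z := -(polL D + polR D)) hg (polInR_comp x)
    ((commute_polL_polR (D := D)).add_left (Commute.refl _)).neg_left (by abel)]
  congr 2
  exact LinearMap.ext fun z => map_subst const_comp_del2 _ _

variable {ι : Type*} [Fintype ι]

theorem coeffwise_sum {V W : Type*} [AddCommGroup V] [Module k V] [AddCommGroup W] [Module k W]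
    (F : ι → V →ₗ[k] W) (p : Pol V) : coeffwise (∑ i, F i) p = ∑ i, coeffwise (F i) p := by
  rw [← LinearMap.sum_apply]
  exact LinearMap.congr_fun (map_sum (AddMonoidHom.mk' coeffwise coeffwise_add) F Finset.univ) p

theorem negLeft_add (h : P →ₗ[k] Pol P) (s t : P ⊗[k] P) :
    negLeft D h (s + t) = negLeft D h s + negLeft D h t := by
  simp only [negLeft, map_add]

theorem negLeft_sub (h : P →ₗ[k] Pol P) (s t : P ⊗[k] P) :
    negLeft D h (s - t) = negLeft D h s - negLeft D h t := by
  simp only [negLeft, map_sub]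

theorem negLeft_sum (h : P →ₗ[k] Pol P) (t : ι → P ⊗[k] P) :
    negLeft D h (∑ i, t i) = ∑ i, negLeft D h (t i) := by
  simp only [negLeft, map_sum]

theorem negRight_add (h : P →ₗ[k] Pol P) (s t : P ⊗[k] P) :
    negRight D h (s + t) = negRight D h s + negRight D h t := by
  simp only [negRight, map_add]

theorem negRight_sub (h : P →ₗ[k] Pol P) (s t : P ⊗[k] P) :
    negRight D h (s - t) = negRight D h s - negRight D h t := by
  simp only [negRight, map_sub]

theorem negRight_sum (h : P →ₗ[k] Pol P) (t : ι → P ⊗[k] P) :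
    negRight D h (∑ i, t i) = ∑ i, negRight D h (t i) := by
  simp only [negRight, map_sum]

theorem coeffwise_sub {V W : Type*} [AddCommGroup V] [Module k V] [AddCommGroup W] [Module k W]
    (h h' : V →ₗ[k] W) : coeffwise (h - h') = coeffwise h - coeffwise h' := by
  refine Finsupp.lhom_ext fun n v => ?_
  simp [coeffwise_single]

theorem rmul_eq (h : IsCommutative D m) (a : P) : rmul D m a = m a :=
  LinearMap.ext fun b => (h a b).symm

theorem coboundaryLie_cocycle (hL : IsLieConformalAlgebra D br) (x y : ι → P) (a b : P) :
    coeffwise (coboundaryLie D br (∑ i, x i ⊗ₜ[k] y i)) (br a b)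
      = (onLeft P (br a) (coboundaryLie D br (∑ i, x i ⊗ₜ[k] y i) b)
          + onRight P (br a) (coboundaryLie D br (∑ i, x i ⊗ₜ[k] y i) b))
        - (negLeft D (br b) (coboundaryLie D br (∑ i, x i ⊗ₜ[k] y i) a)
          + negRight D (br b) (coboundaryLie D br (∑ i, x i ⊗ₜ[k] y i) a)) := by
  have hs := hL.sesquilinear
  have hε := hL.isSigned
  rw [coboundaryLie_eq_sum, coeffwise_sum]
  simp only [LinearMap.sum_apply, map_sum, negLeft_sum, negRight_sum, ← Finset.sum_add_distrib,
    ← Finset.sum_sub_distrib]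
  refine Finset.sum_congr rfl fun i _ => ?_
  simp only [coeffwise_add, LinearMap.add_apply, map_add, negLeft_add, negRight_add,
    coeffwise_coL hε, coeffwise_coR hε, onLeft_coL hs, onLeft_coR hs, onRight_coL hs,
    onRight_coR hs, negLeft_coL hs, negLeft_coR hs, negRight_coL hs, negRight_coR hs,
    neg_one_smul]
  rw [nest_jacobi (R := polR D) hL (polInL_comp (y i)) commute_lam_polL commute_polNeg_polL
      commute_lam_polNeg polNeg_add a b (x i),
    nest_jacobi (R := polL D) hL (polInR_comp (x i)) commute_lam_polR commute_polNeg_polR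
      commute_lam_polNeg (by rw [add_right_comm, polNeg_add]) a b (y i)]
  abel

theorem coboundaryAssoc_derivation (hP : IsPoissonConformalAlgebra D br m) (x y : ι → P)
    (a b : P) :
    coeffwise (coboundaryAssoc D m (∑ i, x i ⊗ₜ[k] y i)) (m a b)
      = onRight P (m a) (coboundaryAssoc D m (∑ i, x i ⊗ₜ[k] y i) b)
        + negLeft D (m b) (coboundaryAssoc D m (∑ i, x i ⊗ₜ[k] y i) a) := by
  have hs := hP.assoc.sesquilinear
  have hε := hP.comm.isSigned
  rw [coboundaryAssoc_eq_sum, coeffwise_sum]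
  simp only [LinearMap.sum_apply, map_sum, negLeft_sum, ← Finset.sum_add_distrib]
  refine Finset.sum_congr rfl fun i _ => ?_
  simp only [coeffwise_sub, LinearMap.sub_apply, map_sub, negLeft_sub,
    coeffwise_coL hε, coeffwise_coR hε, onRight_coL hs, onRight_coR hs, negLeft_coL hs,
    negLeft_coR hs, one_smul]
  rw [← nest_left_comm (R := polR D) hP (polInL_comp (y i)) commute_lam_polL commute_polNeg_polL
      commute_lam_polNeg polNeg_add a b (x i),
    nest_assoc (R := polR D) hP (polInL_comp (y i)) commute_lam_polL commute_polNeg_polL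
      commute_lam_polNeg polNeg_add a b (x i),
    nest_assoc (R := polL D) hP (polInR_comp (x i)) commute_lam_polR commute_polNeg_polR
      commute_lam_polNeg (by rw [add_right_comm, polNeg_add]) a b (y i)]
  abel

/-- The nested terms agree by a(bz) = b(az), and the parallel terms coincide. This is condition 6
before the flip enters; no symmetry of r is needed. -/
theorem coboundaryAssoc_symmetric (hP : IsPoissonConformalAlgebra D br m) (x y : ι → P)
    (a b : P) :
    negLeft D (m b) (coboundaryAssoc D m (∑ i, x i ⊗ₜ[k] y i) a)
        - negRight D (m b) (coboundaryAssoc D m (∑ i, x i ⊗ₜ[k] y i) a)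
      = onLeft P (m a) (coboundaryAssoc D m (∑ i, x i ⊗ₜ[k] y i) b)
        - onRight P (m a) (coboundaryAssoc D m (∑ i, x i ⊗ₜ[k] y i) b) := by
  have hs := hP.assoc.sesquilinear
  rw [coboundaryAssoc_eq_sum]
  simp only [LinearMap.sum_apply, map_sum, negLeft_sum, negRight_sum, ← Finset.sum_sub_distrib]
  refine Finset.sum_congr rfl fun i _ => ?_
  simp only [LinearMap.sub_apply, map_sub, negLeft_sub, negRight_sub, onLeft_coL hs,
    onLeft_coR hs, onRight_coL hs, onRight_coR hs, negLeft_coL hs, negLeft_coR hs,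
    negRight_coL hs, negRight_coR hs]
  rw [nest_left_comm (R := polR D) hP (polInL_comp (y i)) commute_lam_polL commute_polNeg_polL
      commute_lam_polNeg polNeg_add a b (x i),
    nest_left_comm (R := polL D) hP (polInR_comp (x i)) commute_lam_polR commute_polNeg_polR
      commute_lam_polNeg (by rw [add_right_comm, polNeg_add]) a b (y i)]
  abel

theorem coboundaryLie_mul (hP : IsPoissonConformalAlgebra D br m) (x y : ι → P) (a b : P) :
    coeffwise (coboundaryLie D br (∑ i, x i ⊗ₜ[k] y i)) (m a b)
      = onLeft P (m a) (coboundaryLie D br (∑ i, x i ⊗ₜ[k] y i) b)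
        + negLeft D (m b) (coboundaryLie D br (∑ i, x i ⊗ₜ[k] y i) a)
        + onRight P (br a) (coboundaryAssoc D m (∑ i, x i ⊗ₜ[k] y i) b)
        + negRight D (br b) (coboundaryAssoc D m (∑ i, x i ⊗ₜ[k] y i) a) := by
  have hb := hP.lie.sesquilinear
  have hm := hP.assoc.sesquilinear
  have hε := hP.lie.isSigned
  rw [coboundaryLie_eq_sum, coboundaryAssoc_eq_sum, coeffwise_sum]
  simp only [LinearMap.sum_apply, map_sum, negLeft_sum, negRight_sum, ← Finset.sum_add_distrib]
  refine Finset.sum_congr rfl fun i _ => ?_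
  simp only [coeffwise_add, LinearMap.add_apply, LinearMap.sub_apply, map_add, map_sub,
    negLeft_add, negRight_sub, coeffwise_coL hε, coeffwise_coR hε, onLeft_coL hm, onLeft_coR hm,
    onRight_coL hb, onRight_coR hb, negLeft_coL hm, negLeft_coR hm, negRight_coL hb,
    negRight_coR hb, neg_one_smul]
  -- The two slots behave differently. In the second, [yᵢ, ab], [a, b yᵢ] and [b, a yᵢ] balance by
  -- the cyclic identity; in the first, [xᵢ, ab] is expanded by the Leibniz rule.
  have h := nest_leibniz_cycle (R := polL D) hP (polInR_comp (x i)) commute_lam_polR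
    commute_polNeg_polR commute_lam_polNeg (by rw [add_right_comm, polNeg_add]) a b (y i)
  rw [add_assoc] at h
  rw [eq_neg_of_add_eq_zero_left h,
    nest_leibniz_swap (R := polNeg D) hP (polInL_comp (y i)) commute_polL_polR.symm
      commute_lam_polL commute_lam_polR.symm (by rw [polNeg]; abel) (x i) a b]
  abel

theorem coboundaryAssoc_bracket (hP : IsPoissonConformalAlgebra D br m) (x y : ι → P)
    (a b : P) :
    coeffwise (coboundaryAssoc D m (∑ i, x i ⊗ₜ[k] y i)) (br a b)
      = (onLeft P (br a) (coboundaryAssoc D m (∑ i, x i ⊗ₜ[k] y i) b)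
          + onRight P (br a) (coboundaryAssoc D m (∑ i, x i ⊗ₜ[k] y i) b))
        - negRight D (m b) (coboundaryLie D br (∑ i, x i ⊗ₜ[k] y i) a)
        + negLeft D (m b) (coboundaryLie D br (∑ i, x i ⊗ₜ[k] y i) a) := by
  have hb := hP.lie.sesquilinear
  have hm := hP.assoc.sesquilinear
  have hε := hP.comm.isSigned
  rw [coboundaryLie_eq_sum, coboundaryAssoc_eq_sum, coeffwise_sum]
  simp only [LinearMap.sum_apply, map_sum, negLeft_sum, negRight_sum, ← Finset.sum_add_distrib,
    ← Finset.sum_sub_distrib]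
  refine Finset.sum_congr rfl fun i _ => ?_
  simp only [coeffwise_sub, LinearMap.add_apply, LinearMap.sub_apply, map_sub,
    negLeft_add, negRight_add, coeffwise_coL hε, coeffwise_coR hε, onLeft_coL hb, onLeft_coR hb,
    onRight_coL hb, onRight_coR hb, negLeft_coL hm, negLeft_coR hm, negRight_coL hm,
    negRight_coR hm, one_smul]
  rw [nest_leibniz (R := polR D) hP (polInL_comp (y i)) commute_lam_polL commute_polNeg_polL
      commute_lam_polNeg polNeg_add a b (x i),
    nest_leibniz (R := polL D) hP (polInR_comp (x i)) commute_lam_polR commute_polNeg_polR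
      commute_lam_polNeg (by rw [add_right_comm, polNeg_add]) a b (y i)]
  abel

end Compatibility

/-! ### The flip and the coboundary maps -/

section Flip

variable {k : Type*} [Field k] {P : Type*} [AddCommGroup P] [Module k P]
variable {D : Module.End k P}

theorem coeffwise_tau_onLeft (g : P →ₗ[k] Pol P) (t : P ⊗[k] P) :
    coeffwise (tau k P) (onLeft P g t) = onRight P g (tau k P t) := by
  induction t with
  | zero => simp
  | add s t hs ht => simp only [map_add, hs, ht]
  | tmul u v =>
    rw [onLeft_tmul, coeffwise_coeffwise]
    exact (onRight_tmul g v u).symm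

theorem coeffwise_tau_onRight (g : P →ₗ[k] Pol P) (t : P ⊗[k] P) :
    coeffwise (tau k P) (onRight P g t) = onLeft P g (tau k P t) := by
  induction t with
  | zero => simp
  | add s t hs ht => simp only [map_add, hs, ht]
  | tmul u v =>
    rw [onRight_tmul, coeffwise_coeffwise]
    exact (onLeft_tmul g v u).symm

theorem tau_evalAt (p : Pol (P ⊗[k] P)) :
    tau k P (evalAt (-del2 D) p) = evalAt (-del2 D) (coeffwise (tau k P) p) := by
  rw [evalAt_coeffwise, evalAt, map_subst (T' := -del2 D), LinearMap.comp_id]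
  ext u v
  simp [tau, del2, add_comm]

variable {br m : P →ₗ[k] P →ₗ[k] Pol P}

/-- The operator ad(a) ⊗ I + I ⊗ ad(a) is symmetric in the two slots, hence commutes with τ.
Condition (a) thereby becomes skew-symmetry of δ. -/
theorem evalAt_add_tau (a : P) (r : P ⊗[k] P) :
    evalAt (-del2 D) ((onLeft P (br a) + onRight P (br a)) (r + tau k P r))
      = coboundaryLie D br r a + tau k P (coboundaryLie D br r a) := by
  change _ = evalAt (-del2 D) ((onLeft P (br a) + onRight P (br a)) r)
    + tau k P (evalAt (-del2 D) ((onLeft P (br a) + onRight P (br a)) r))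
  simp only [tau_evalAt, LinearMap.add_apply, map_add, coeffwise_tau_onLeft,
    coeffwise_tau_onRight]
  abel

/-- The operator I ⊗ L(a) - L(a) ⊗ I changes sign under τ, which accounts for the minus sign;
condition (b) becomes cocommutativity of Δ. -/
theorem evalAt_sub_tau (a : P) (r : P ⊗[k] P) :
    evalAt (-del2 D) ((onRight P (m a) - onLeft P (m a)) (r + tau k P r))
      = coboundaryAssoc D m r a - tau k P (coboundaryAssoc D m r a) := by
  change _ = evalAt (-del2 D) ((onRight P (m a) - onLeft P (m a)) r)
    - tau k P (evalAt (-del2 D) ((onRight P (m a) - onLeft P (m a)) r))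
  simp only [tau_evalAt, LinearMap.sub_apply, map_add, map_sub, coeffwise_tau_onLeft,
    coeffwise_tau_onRight]
  abel

theorem coboundaryLie_equivariant (hs : IsSesquilinear D br) (r : P ⊗[k] P) :
    IsEquivariant D (coboundaryLie D br r) := fun a => by
  change evalAt (-del2 D) ((onLeft P (br (D a)) + onRight P (br (D a))) r)
    = del2 D (evalAt (-del2 D) ((onLeft P (br a) + onRight P (br a)) r))
  induction r with
  | zero => simp
  | add s t hs ht => simp only [map_add, hs, ht]
  | tmul u v =>
    simp only [LinearMap.add_apply, map_add, evalAt_onLeft_tmul, evalAt_onRight_tmul]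
    congr 1
    · exact LinearMap.congr_fun (coL_equivariant hs u v) a
    · exact LinearMap.congr_fun (coR_equivariant hs u v) a

theorem coboundaryAssoc_equivariant (hs : IsSesquilinear D m) (r : P ⊗[k] P) :
    IsEquivariant D (coboundaryAssoc D m r) := fun a => by
  change evalAt (-del2 D) ((onRight P (m (D a)) - onLeft P (m (D a))) r)
    = del2 D (evalAt (-del2 D) ((onRight P (m a) - onLeft P (m a)) r))
  induction r with
  | zero => simp
  | add s t hs ht => simp only [map_add, hs, ht]
  | tmul u v =>
    simp only [LinearMap.sub_apply, map_sub, evalAt_onLeft_tmul, evalAt_onRight_tmul]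
    congr 1
    · exact LinearMap.congr_fun (coR_equivariant hs u v) a
    · exact LinearMap.congr_fun (coL_equivariant hs u v) a

end Flip

/-! ### Reduction of the bialgebra property to the coalgebra axioms -/

section CoalgebraCriterion

variable {k : Type*} [Field k] {P : Type*} [AddCommGroup P] [Module k P]
variable {D : Module.End k P} {br m : P →ₗ[k] P →ₗ[k] Pol P}
variable {ι : Type*} [Fintype ι] {x y : ι → P} {r : P ⊗[k] P}

/-- Given a Poisson conformal algebra, the coboundary maps of `r` give a bialgebra as soon as they
give a coalgebra. -/
theorem isPoissonConformalBialgebra_of_coalgebra (hP : IsPoissonConformalAlgebra D br m)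
    (hr : r = ∑ i, x i ⊗ₜ[k] y i)
    (h : IsPoissonConformalCoalgebra D (coboundaryLie D br r) (coboundaryAssoc D m r)) :
    IsPoissonConformalBialgebra D br m (coboundaryLie D br r) (coboundaryAssoc D m r) := by
  subst hr
  refine ⟨hP, h, ⟨hP.lie, h.lie, coboundaryLie_cocycle hP.lie x y⟩,
    ⟨hP.assoc, h.coassoc, fun a b => ?_, fun a b => ?_⟩, hP.comm, h.cocomm,
    coboundaryLie_mul hP x y, coboundaryAssoc_bracket hP x y⟩
  · rw [rmul_eq hP.comm]
    exact coboundaryAssoc_derivation hP x y a b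
  -- Condition 6 now reads X + τX = 0 with X = (L(a) ⊗ I - I ⊗ L(a))Δ(b). The flip exchanges the two
  -- operators and, by cocommutativity, fixes Δ(b), so τX = -X.
  · rw [rmul_eq hP.comm, rmul_eq hP.comm, coboundaryAssoc_symmetric hP, map_sub,
      coeffwise_tau_onLeft, coeffwise_tau_onRight, ← h.cocomm b]
    abel

end CoalgebraCriterion

end PoissonConformal

end

/-! ### The equivalence -/

theorem theorem3p10 {k : Type*} [Field k] [CharZero k] {P : Type*} [AddCommGroup P] [Module k P]
    (D : Module.End k P)
    (br m : P →ₗ[k] P →ₗ[k] PoissonConformal.Pol P)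
    (hP : PoissonConformal.IsPoissonConformalAlgebra D br m)
    {ι : Type*} [Fintype ι] (x y : ι → P) (r : P ⊗[k] P) (hr : r = ∑ i, x i ⊗ₜ[k] y i) :
    PoissonConformal.IsPoissonConformalBialgebra D br m
        (PoissonConformal.coboundaryLie D br r) (PoissonConformal.coboundaryAssoc D m r) ↔
      ∀ a : P,
        -- (a)
        PoissonConformal.evalAt (-PoissonConformal.del2 D)
            ((PoissonConformal.onLeft P (br a) + PoissonConformal.onRight P (br a))
              (r + PoissonConformal.tau k P r)) = 0 ∧
        -- (b)
        PoissonConformal.evalAt (-PoissonConformal.del2 D)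
            ((PoissonConformal.onRight P (m a) - PoissonConformal.onLeft P (m a))
              (r + PoissonConformal.tau k P r)) = 0 ∧
        -- (c)
        PoissonConformal.evalAt (-PoissonConformal.del3 D)
            ((PoissonConformal.onA (br a) + PoissonConformal.onB (br a)
              + PoissonConformal.onC (br a)) (PoissonConformal.cybe D br x y)) = 0 ∧
        -- (d)
        PoissonConformal.evalAt (-PoissonConformal.del3 D)
            ((PoissonConformal.onC (m a) - PoissonConformal.onA (m a))
              (PoissonConformal.aybe D m x y)) = 0 ∧
        -- (e)
        PoissonConformal.evalAt (-PoissonConformal.del3 D)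
              (PoissonConformal.onA (br a) (PoissonConformal.aybe D m x y))
            - PoissonConformal.evalAt (-PoissonConformal.del3 D)
              ((PoissonConformal.onB (m a) - PoissonConformal.onC (m a))
                (PoissonConformal.cybe D br x y))
            + ∑ i, PoissonConformal.evalAt (PoissonConformal.delC D)
                (PoissonConformal.onA (br (x i))
                  (PoissonConformal.evalAt
                    (-(PoissonConformal.delA D + PoissonConformal.delB D))
                    ((PoissonConformal.onA (m a) - PoissonConformal.onB (m a))
                      (PoissonConformal.tensorRight (r + PoissonConformal.tau k P r) (y i))))) = 0 := by
  open PoissonConformal in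
  have hc : ∀ a, evalAt (-del3 D) ((onA (br a) + onB (br a) + onC (br a)) (cybe D br x y))
      = actA (-del3 D) (br a) (cybe D br x y) + actB (-del3 D) (br a) (cybe D br x y)
        + actC (-del3 D) (br a) (cybe D br x y) := fun a => by
    rw [LinearMap.add_apply, LinearMap.add_apply, map_add, map_add]; rfl
  open PoissonConformal in
  have hd : ∀ a, evalAt (-del3 D) ((onC (m a) - onA (m a)) (aybe D m x y))
      = actC (-del3 D) (m a) (aybe D m x y) - actA (-del3 D) (m a) (aybe D m x y) := fun a => by
    rw [LinearMap.sub_apply, map_sub]; rfl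
  open PoissonConformal in
  have he : ∀ a, evalAt (-del3 D) (onA (br a) (aybe D m x y))
        - evalAt (-del3 D) ((onB (m a) - onC (m a)) (cybe D br x y))
      = actA (-del3 D) (br a) (aybe D m x y)
        - (actB (-del3 D) (m a) (cybe D br x y) - actC (-del3 D) (m a) (cybe D br x y)) :=
    fun a => by rw [LinearMap.sub_apply, map_sub]; rfl
  have hJ := PoissonConformal.cojacobi_defect hP.lie x y
  have hA := PoissonConformal.coassoc_defect hP x y
  have hE := PoissonConformal.coleibniz_defect hP x y
  rw [← hr] at hJ hA hE
  simp only [hc, hd, he]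
  simp only [PoissonConformal.evalAt_add_tau] at hJ ⊢
  simp only [PoissonConformal.evalAt_sub_tau]
  constructor
  · intro h a
    have ha : PoissonConformal.coboundaryLie D br r a
        + PoissonConformal.tau k P (PoissonConformal.coboundaryLie D br r a) = 0 :=
      add_eq_zero_iff_eq_neg.mpr (h.coalg.lie.coskew a)
    refine ⟨ha, sub_eq_zero.mpr (h.cocomm a), ?_, ?_, ?_⟩
    · have := hJ a
      -- Skew-symmetry of δ annihilates the correction, so the vanishing co-Jacobi defect is exactly
      -- the left side of (c).
      rw [h.coalg.lie.cojacobi a, sub_self, ha] at this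
      simpa [PoissonConformal.tensorRight_zero] using this.symm
    · rw [← hA a, h.coalg.coassoc.coassoc a, sub_self]
    · refine (hE a).symm.trans ?_
      rw [h.coalg.compat a]
      abel
  · intro h
    refine PoissonConformal.isPoissonConformalBialgebra_of_coalgebra hP hr
      ⟨⟨PoissonConformal.coboundaryLie_equivariant hP.lie.sesquilinear r,
        fun a => add_eq_zero_iff_eq_neg.mp (h a).1, fun a => sub_eq_zero.mp ?_⟩,
      ⟨PoissonConformal.coboundaryAssoc_equivariant hP.assoc.sesquilinear r,
        fun a => sub_eq_zero.mp ((hA a).trans (h a).2.2.2.1)⟩,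
      fun a => sub_eq_zero.mp (h a).2.1, fun a => ?_⟩
    · rw [hJ a, (h a).1, (h a).2.2.1]
      simp [PoissonConformal.tensorRight_zero]
    · have := (hE a).trans (h a).2.2.2.2
      rw [sub_sub] at this
      exact sub_eq_zero.mp this
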